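/- Let $q(z,\sigma)=\tilde q(|z|,\theta)\ge 0$ be a measurable collision kernel on $\mathbb R^3\times S^2$, where $\theta$ is the angle between $z$ and $\sigma$. Put $v'=\tfrac12(v+v_1)+\tfrac12|v-v_1|\sigma$, $v_1'=\tfrac12(v+v_1)-\tfrac12|v-v_1|\sigma$, write $g,g_1,g',g_1'$ for the values of $g$ at $v,v_1,v',v_1'$, and define $$Q(f,g)(v)=\int_{\mathbb R^3}\int_{S^2} q(v-v_1,\sigma)\,(f_1'g'-f_1g)\,d\sigma\,dv_1,\qquad L[f]\psi=f^{-1}\big[Q(f,f\psi)+Q(f\psi,f)\big],$$ $$L^*[f]\gamma(v)=\int_{\mathbb R^3}\int_{S^2} f_1\,(\gamma'+\gamma_1'-\gamma-\gamma_1)\,q(v-v_1,\sigma)\,d\sigma\,dv_1 .$$ (a) $L^*[f]$ is the $L^2(f\,dv)$-adjoint of $L[f]$: if $f$ is measurable and positive almost everywhere, and $\psi,\varphi$ are measurable functions such that $q f f_1\psi\varphi$, $q f f_1\psi\varphi_1$, $q f f_1\psi\varphi'$ and $q f f_1\psi\varphi_1'$ are integrable with respect to $dv\,dv_1\,d\sigma$,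 then $(L[f]\psi)\varphi f$ and $\psi (L^*[f]\varphi) f$ are integrable and $$\int_{\mathbb R^3} (L[f]\psi)\,\varphi\, f\,dv=\int_{\mathbb R^3}\psi\,(L^*[f]\varphi)\, f\,dv .$$ (b) Suppose in addition that $q$ is of Maxwell type with angular cutoff, i.e. $\sup_z\int_{S^2}q(z,\sigma)\,d\sigma<\infty$ (for instance $q$ constant). Let $T>0$ and $k\ge0$, let $w(v)=(1+|v|^2)^{k/2}$, and let $L^1_k$ be the space with norm $\int|g|\,w\,dv$. Let $r$ be a measurable function with $|r|\le C w$ for some constant $C$. Let $U$ be an open subset of a real normed space and let $f_0(\cdot;\alpha)\in L^1_k$ be initial data such that $\alpha\mapsto f_0(\cdot;\alpha)\in L^1_k$ is Fréchet differentiable on $U$, with derivative $\partial_\alpha f_0(\cdot;\alpha)$. For every $\alpha\in U$ let $f=f(v,t;\alpha)$ be a solution of the spatially homogeneous Boltzmann equation $\partial_t f=Q(f,f)$ on $[0,T]$ (for almost every $v$ and all $t\in[0,T]$), measurable in $(v,t)$ and bounded in $L^1_k$ uniformly in $t\in[0,T]$, with $f(\cdot,0;\alpha)=f_0(\cdot;\alpha)$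 almost everywhere. Let $J_1(\alpha)=\int_{\mathbb R^3} r(v)f(v,T;\alpha)\,dv$. Then for every $\alpha\in U$ the backward problem $$-\partial_t\gamma=L^*[f]\gamma\quad (v\in\mathbb R^3,\ 0\le t\le T),\qquad \gamma(v,T)=-r(v),$$ with $f=f(\cdot,\cdot;\alpha)$, has a solution $\gamma$ that is measurable in $(v,t)$ and satisfies $|\gamma(v,t)|\le C' w(v)$ on $\mathbb R^3\times[0,T]$ for some constant $C'$. For every such solution $\gamma$, the function $J_1$ is Fréchet differentiable at $\alpha$ and $$\partial_\alpha J_1(\alpha)=-\int_{\mathbb R^3}\gamma(v,0)\,\partial_\alpha f_0(v;\alpha)\,dv ,$$ that is, for every direction $h$ the function $\gamma(\cdot,0)\,\partial_\alpha f_0(\cdot;\alpha)[h]$ is integrable and the derivative of $J_1$ at $\alpha$ in direction $h$ equals minus its integral. -/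

import Mathlib

open MeasureTheory Set
open scoped NNReal ENNReal

noncomputable section

namespace Boltzmann

/-- The velocity space `ℝ³` with its Euclidean norm. -/
abbrev Vel : Type := EuclideanSpace ℝ (Fin 3)

/-- The unit sphere `S²` of `ℝ³`. -/
abbrev Sph : Type := Metric.sphere (0 : Vel) 1

/-- The surface measure `dσ` of the unit sphere (total mass `4π`). -/
def surf : Measure Sph := (volume : Measure Vel).toSphere

/-- A collision kernel `q(z, σ) = q̃(|z|, θ)`: a nonnegative measurable function of the relative
speed `|z|` and of the scattering angle `θ` between `z` and `σ`. -/
structure CollisionKernel where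
  /-- The function `q̃` of relative speed and scattering angle. -/
  profile : ℝ → ℝ → ℝ
  measurable_profile : Measurable (Function.uncurry profile)
  profile_nonneg : ∀ ρ θ, 0 ≤ profile ρ θ

/-- The value `q(z, σ) = q̃(|z|, θ)`, where `θ = arccos (σ · z / |z|)`. -/
def CollisionKernel.eval (q : CollisionKernel) (z : Vel) (σ : Sph) : ℝ :=
  q.profile ‖z‖ (InnerProductGeometry.angle z (σ : Vel))

/-- Maxwell-type kernels with angular cutoff: the total collision rate `∫ q(z, σ) dσ` is bounded
uniformly in the relative velocity `z`. -/
def CollisionKernel.IsCutoff (q : CollisionKernel) : Prop :=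
  ∃ Λ : ℝ≥0, ∀ z : Vel, ∫⁻ σ, ENNReal.ofReal (q.eval z σ) ∂surf ≤ Λ

/-- The post-collisional velocity `v' = (v + v₁) / 2 + |v - v₁| σ / 2`. -/
def post (v v₁ : Vel) (σ : Sph) : Vel :=
  (1 / 2 : ℝ) • (v + v₁) + (1 / 2 * ‖v - v₁‖) • (σ : Vel)

/-- The post-collisional velocity `v₁' = (v + v₁) / 2 - |v - v₁| σ / 2`. -/
def post₁ (v v₁ : Vel) (σ : Sph) : Vel :=
  (1 / 2 : ℝ) • (v + v₁) - (1 / 2 * ‖v - v₁‖) • (σ : Vel)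

/-- The bilinear collision operator
`Q(f, g)(v) = ∫∫ q(v - v₁, σ) (f(v₁') g(v') - f(v₁) g(v)) dσ dv₁`. -/
def collision (q : CollisionKernel) (f g : Vel → ℝ) (v : Vel) : ℝ :=
  ∫ v₁ : Vel, ∫ σ : Sph,
    q.eval (v - v₁) σ * (f (post₁ v v₁ σ) * g (post v v₁ σ) - f v₁ * g v) ∂surf

/-- The linearized operator `L[f] ψ = f⁻¹ (Q(f, f ψ) + Q(f ψ, f))`. -/
def linearized (q : CollisionKernel) (f ψ : Vel → ℝ) (v : Vel) : ℝ :=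
  (f v)⁻¹ * (collision q f (fun w => f w * ψ w) v + collision q (fun w => f w * ψ w) f v)

/-- The operator `L*[f] γ = ∫∫ f₁ (γ' + γ₁' - γ - γ₁) q dσ dv₁`. -/
def linearizedAdjoint (q : CollisionKernel) (f γ : Vel → ℝ) (v : Vel) : ℝ :=
  ∫ v₁ : Vel, ∫ σ : Sph,
    f v₁ * (γ (post v v₁ σ) + γ (post₁ v v₁ σ) - γ v - γ v₁) * q.eval (v - v₁) σ ∂surf

/-- The measure `dv dv₁ dσ` on `ℝ³ × ℝ³ × S²`. -/
def collisionMeasure : Measure (Vel × Vel × Sph) :=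
  (volume : Measure Vel).prod ((volume : Measure Vel).prod surf)

/-- The functions `q f f₁ ψ φ`, `q f f₁ ψ φ₁`, `q f f₁ ψ φ'` and `q f f₁ ψ φ₁'` are integrable
with respect to `dv dv₁ dσ`. -/
structure PairingIntegrable (q : CollisionKernel) (f ψ φ : Vel → ℝ) : Prop where
  pre : Integrable (fun p : Vel × Vel × Sph =>
    q.eval (p.1 - p.2.1) p.2.2 * (f p.1 * f p.2.1 * ψ p.1 * φ p.1)) collisionMeasure
  pre₁ : Integrable (fun p : Vel × Vel × Sph =>
    q.eval (p.1 - p.2.1) p.2.2 * (f p.1 * f p.2.1 * ψ p.1 * φ p.2.1)) collisionMeasure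
  post : Integrable (fun p : Vel × Vel × Sph =>
    q.eval (p.1 - p.2.1) p.2.2 * (f p.1 * f p.2.1 * ψ p.1 * φ (post p.1 p.2.1 p.2.2)))
      collisionMeasure
  post₁ : Integrable (fun p : Vel × Vel × Sph =>
    q.eval (p.1 - p.2.1) p.2.2 * (f p.1 * f p.2.1 * ψ p.1 * φ (post₁ p.1 p.2.1 p.2.2)))
      collisionMeasure

/-- `L*[f]` is the adjoint of `L[f]` for the inner product `(h₁, h₂) = ∫ h₁ h₂ f dv` of
`L²(f dv)`, on all pairs of functions for which the collision integrals involved converge. -/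
def IsAdjointPair (q : CollisionKernel) (f : Vel → ℝ) : Prop :=
  ∀ ψ φ : Vel → ℝ, Measurable ψ → Measurable φ → PairingIntegrable q f ψ φ →
    Integrable (fun v => linearized q f ψ v * φ v * f v) ∧
    Integrable (fun v => ψ v * linearizedAdjoint q f φ v * f v) ∧
    ∫ v, linearized q f ψ v * φ v * f v = ∫ v, ψ v * linearizedAdjoint q f φ v * f v

/-- The weight `(1 + |v|²)^(k/2)`. -/
def weight (k : ℝ) (v : Vel) : ℝ := (1 + ‖v‖ ^ 2) ^ (k / 2)

/-- The weighted Lebesgue space `L¹_k` with norm `∫ |g(v)| (1 + |v|²)^(k/2) dv`. -/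
abbrev WeightedL1 (k : ℝ) : Type :=
  Lp ℝ 1 ((volume : Measure Vel).withDensity fun v => ENNReal.ofReal (weight k v))

/-- `f = f(t, v)` solves the spatially homogeneous Boltzmann equation `∂ₜ f = Q(f, f)` on `[0, T]`,
in the class of measurable functions that are bounded in `L¹_k` on `[0, T]`. -/
structure IsSolution (q : CollisionKernel) (k T : ℝ) (f : ℝ → Vel → ℝ) : Prop where
  measurable : Measurable (Function.uncurry f)
  integrable : ∀ t ∈ Icc 0 T, Integrable fun v => weight k v * f t v
  bounded : ∃ C : ℝ, ∀ t ∈ Icc 0 T, ∫ v, weight k v * |f t v| ≤ C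
  equation : ∀ᵐ v : Vel, ∀ t ∈ Icc 0 T,
    HasDerivWithinAt (fun s => f s v) (collision q (f t) (f t) v) (Icc 0 T) t

/-- `γ = γ(t, v)` solves the backward problem `-∂ₜ γ = L*[f] γ` on `[0, T]`, `γ(T, v) = -r(v)`,
in the class of measurable functions with `|γ(t, v)| ≤ C (1 + |v|²)^(k/2)`. -/
structure IsAdjointSolution (q : CollisionKernel) (k T : ℝ) (f : ℝ → Vel → ℝ) (r : Vel → ℝ)
    (γ : ℝ → Vel → ℝ) : Prop where
  measurable : Measurable (Function.uncurry γ)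
  bounded : ∃ C : ℝ, ∀ t ∈ Icc 0 T, ∀ v, |γ t v| ≤ C * weight k v
  equation : ∀ v : Vel, ∀ t ∈ Icc 0 T,
    HasDerivWithinAt (fun s => γ s v) (-linearizedAdjoint q (f t) (γ t) v) (Icc 0 T) t
  final : ∀ v : Vel, γ T v = -r v

/-- The objective `J₁(α) = ∫ r(v) f(v, T; α) dv`. -/
def objective {A : Type*} (r : Vel → ℝ) (T : ℝ) (f : A → ℝ → Vel → ℝ) (α : A) : ℝ :=
  ∫ v, r v * f α T v

end Boltzmann

end

/-!
*Duality.* The map `scatter : (v, v₁, σ) ↦ (v', v₁', (v - v₁) / |v - v₁|)` preserves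
`dv dv₁ dσ`: in the centre-of-mass variable `V = (v + v₁) / 2` and the relative velocity
`z = v - v₁ = ρ ω` it is the exchange of `ω` and `σ`. It is an involution almost everywhere and
leaves the kernel `q` invariant, so the gain term of `Q(g, h)` can be carried over to the test
function (`collision_weak`). Relabelling the two particles by `(v, v₁, σ) ↦ (v₁, v, -σ)` brings
`∫ φ (Q(f, u) + Q(u, f))` to the form `∫ u L*[f] φ` (`linearizedAdjoint_duality`).

*The gradient.* Let `w` be the weight of `L¹_k`. Since `w(v') ≤ w(v) w(v₁)`, a bounded collision
rate makes all trilinear integrals of the weak formulation converge for densities in `L¹_k` and test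
functions of growth at most `w`. Testing with `w sign(...)` shows that `g ↦ Q(g, g)` is locally
Lipschitz in `L¹_k` (`wnorm_collision_sub_le`), and the remainder of its linearization at `f`,
tested through `L*[f]`, is quadratic (`abs_collision_sub_linearization_le`).

* A solution, given pointwise in `v`, is a differentiable curve in `L¹_k`
  (`IsSolution.hasDerivWithinAt_toWeightedL1`), and two solutions with close initial data stay close
  on `[0, T]` (`IsSolution.wnorm_sub_le_exp`).
* `L*[f(t)]`, conjugated by `w`, is a bounded linear operator on the space of bounded measurable
  functions and depends continuously on `t`; the backward problem is a linear equation there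
  (`IsSolution.exists_isAdjointSolution`).
* For solutions `f` and `g` put `d = g - f`. Then `∫ γ d dv` has the time derivative
  `∫ γ (Q(g, g) - Q(f, f)) - ∫ d L*[f] γ`, which is quadratic in `d`. Hence the objective changes by
  `-∫ γ(0) d(0)` up to an error quadratic in the change of the initial datum
  (`IsAdjointSolution.abs_objective_sub_le`), which is the gradient formula.
-/

/-! ### The collision transformation preserves the measure -/

namespace Boltzmann

instance : IsFiniteMeasure surf := by unfold surf; infer_instance

open Measure in
theorem measurePreserving_neg_surf : MeasurePreserving (fun σ : Sph => -σ) surf surf := by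
  refine ⟨measurable_neg, ?_⟩
  ext s hs
  have hs' : MeasurableSet ((fun σ : Sph => -σ) ⁻¹' s) := measurable_neg hs
  rw [map_apply measurable_neg hs, surf, toSphere_apply' _ hs', toSphere_apply' _ hs]
  congr 1
  rw [← measure_preimage_neg]
  congr 1
  ext x
  simp only [mem_preimage, mem_smul, mem_image]
  constructor
  · rintro ⟨c, hc, _, ⟨y, hy, rfl⟩, hx⟩
    exact ⟨c, hc, _, ⟨-y, hy, rfl⟩, by simp [hx]⟩
  · rintro ⟨c, hc, _, ⟨y, hy, rfl⟩, hx⟩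
    exact ⟨c, hc, _, ⟨-y, by simpa using hy, rfl⟩, by simp [hx]⟩

/-- The direction `z / |z|` of a relative velocity; the junk value at `z = 0` is `σ`. -/
noncomputable def direction (z : Vel) (σ : Sph) : Sph :=
  ⟨if z = 0 then (σ : Vel) else ‖z‖⁻¹ • z, by
    split_ifs with h
    · exact σ.2
    · simp [norm_smul, h]⟩

theorem measurable_direction : Measurable fun p : Vel × Sph => direction p.1 p.2 := by
  refine Measurable.subtype_mk (Measurable.ite (measurable_fst (measurableSet_singleton 0)) ?_ ?_)
  · fun_prop
  · fun_prop

/-- The exchange of the direction of the relative velocity with the scattering direction. -/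
noncomputable def exchange (p : Vel × Sph) : Vel × Sph := (‖p.1‖ • (p.2 : Vel), direction p.1 p.2)

theorem measurable_exchange : Measurable exchange :=
  Measurable.prodMk (by fun_prop) measurable_direction

/-- Polar coordinates `(ω, ρ) ↦ ρ ω` on the velocity space. -/
noncomputable def polar (p : Sph × Ioi (0 : ℝ)) : Vel := (p.2 : ℝ) • (p.1 : Vel)

open Measure in
theorem measurePreserving_polar :
    MeasurePreserving polar (surf.prod (volumeIoiPow (Module.finrank ℝ Vel - 1))) volume := by
  have h := (measurePreserving_homeomorphUnitSphereProd (volume : Measure Vel)).symm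
    (homeomorphUnitSphereProd Vel).toMeasurableEquiv
  have h2 : MeasurePreserving ((↑) : ({0}ᶜ : Set Vel) → Vel)
      ((volume : Measure Vel).comap (↑)) volume := by
    refine ⟨measurable_subtype_coe, ?_⟩
    rw [map_comap_subtype_coe (measurableSet_singleton 0).compl]
    exact Measure.restrict_eq_self_of_ae_mem (compl_mem_ae_iff.2 (measure_singleton 0))
  exact h2.comp h

/-- In the polar coordinates `z = ρ ω` the exchange is `(ω, ρ, σ) ↦ (σ, ρ, ω)`. -/
theorem measurePreserving_exchange :
    MeasurePreserving exchange ((volume : Measure Vel).prod surf) (volume.prod surf) := by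
  have hA := measurePreserving_polar.prod (MeasurePreserving.id surf)
  have hS : MeasurePreserving
      (fun p : (Sph × Ioi (0 : ℝ)) × Sph => ((p.2, p.1.2), p.1.1))
      ((surf.prod (Measure.volumeIoiPow (Module.finrank ℝ Vel - 1))).prod surf)
      ((surf.prod (Measure.volumeIoiPow (Module.finrank ℝ Vel - 1))).prod surf) := by
    have h1 := (Measure.measurePreserving_swap
      (μ := surf) (ν := Measure.volumeIoiPow (Module.finrank ℝ Vel - 1))).prod
      (MeasurePreserving.id surf)
    have h2 := measurePreserving_prodAssoc
      (Measure.volumeIoiPow (Module.finrank ℝ Vel - 1)) surf surf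
    have h3 := (MeasurePreserving.id (Measure.volumeIoiPow (Module.finrank ℝ Vel - 1))).prod
      (Measure.measurePreserving_swap (μ := surf) (ν := surf))
    have h4 := (measurePreserving_prodAssoc
      (Measure.volumeIoiPow (Module.finrank ℝ Vel - 1)) surf surf).symm
    have h5 := (Measure.measurePreserving_swap
      (μ := Measure.volumeIoiPow (Module.finrank ℝ Vel - 1)) (ν := surf)).prod
      (MeasurePreserving.id surf)
    exact h5.comp (h4.comp (h3.comp (h2.comp h1)))
  have hcomp : exchange ∘ Prod.map polar id =
      Prod.map polar id ∘ (fun p : (Sph × Ioi (0 : ℝ)) × Sph => ((p.2, p.1.2), p.1.1)) := by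
    funext ⟨⟨ω, ρ⟩, σ⟩
    have hρ : (0 : ℝ) < ρ := ρ.2
    have hω : ‖(ω : Vel)‖ = 1 := by simp
    have hω0 : (ω : Vel) ≠ 0 := by
      intro h; simp [h] at hω
    simp [exchange, polar, direction, norm_smul, abs_of_pos hρ, hω0, hρ.ne', smul_smul]
  refine ⟨measurable_exchange, ?_⟩
  conv_lhs => rw [← hA.map_eq]
  rw [Measure.map_map measurable_exchange hA.measurable, hcomp, (hA.comp hS).map_eq]

/-- The passage `(v, v₁, σ) ↦ (v', v₁', (v - v₁) / |v - v₁|)` from pre- to post-collisional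
variables. -/
noncomputable def scatter (p : Vel × Vel × Sph) : Vel × Vel × Sph :=
  (post p.1 p.2.1 p.2.2, post₁ p.1 p.2.1 p.2.2, direction (p.1 - p.2.1) p.2.2)

/-- In the centre-of-mass variable `V = (v + v₁) / 2` and the relative velocity `z = v - v₁`,
scattering leaves `V` fixed and exchanges the direction of `z` with `σ`. -/
theorem measurePreserving_scatter :
    MeasurePreserving scatter collisionMeasure collisionMeasure := by
  have h1 : MeasurePreserving (fun p : Vel × Vel × Sph => (p.1, p.1 - p.2.1, p.2.2))
      ((volume : Measure Vel).prod ((volume : Measure Vel).prod surf))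
      ((volume : Measure Vel).prod ((volume : Measure Vel).prod surf)) := by
    refine (MeasurePreserving.id volume).skew_product
      (g := fun (v : Vel) (p : Vel × Sph) => (v - p.1, p.2)) (by fun_prop) (.of_forall fun v => ?_)
    exact ((Measure.measurePreserving_sub_left volume v).prod (MeasurePreserving.id surf)).map_eq
  have h2 := Measure.measurePreserving_swap (μ := (volume : Measure Vel))
    (ν := (volume : Measure Vel).prod surf)
  have h3 (c : ℝ) : MeasurePreserving (fun p : (Vel × Sph) × Vel => (p.1, p.2 + c • p.1.1))
      (((volume : Measure Vel).prod surf).prod volume)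
      (((volume : Measure Vel).prod surf).prod volume) := by
    refine (MeasurePreserving.id (volume.prod surf)).skew_product
      (g := fun (p : Vel × Sph) (v : Vel) => v + c • p.1) (by fun_prop) (.of_forall fun p => ?_)
    exact (measurePreserving_add_right volume _).map_eq
  have h4 := measurePreserving_exchange.prod (MeasurePreserving.id (volume : Measure Vel))
  have h5 := Measure.measurePreserving_swap (μ := (volume : Measure Vel).prod surf)
    (ν := (volume : Measure Vel))
  have h := h1.comp (h5.comp ((h3 (1 / 2)).comp (h4.comp ((h3 (-(1 / 2))).comp (h2.comp h1)))))
  unfold collisionMeasure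
  convert h using 1
  funext ⟨v, v₁, σ⟩
  simp only [scatter, post, post₁, exchange, Function.comp, Prod.map, Prod.swap, id,
    Prod.mk.injEq, and_true]
  constructor <;> module

theorem measurable_post : Measurable fun p : Vel × Vel × Sph => post p.1 p.2.1 p.2.2 :=
  measurable_fst.comp measurePreserving_scatter.measurable

theorem measurable_post₁ : Measurable fun p : Vel × Vel × Sph => post₁ p.1 p.2.1 p.2.2 :=
  measurable_fst.comp (measurable_snd.comp measurePreserving_scatter.measurable)

theorem post_sub_post₁ (v v₁ : Vel) (σ : Sph) :
    post v v₁ σ - post₁ v v₁ σ = ‖v - v₁‖ • (σ : Vel) := by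
  unfold post post₁; module

theorem norm_post_sub_post₁ (v v₁ : Vel) (σ : Sph) :
    ‖post v v₁ σ - post₁ v v₁ σ‖ = ‖v - v₁‖ := by
  simp [post_sub_post₁, norm_smul]

theorem post_add_post₁ (v v₁ : Vel) (σ : Sph) :
    post v v₁ σ + post₁ v v₁ σ = v + v₁ := by
  unfold post post₁; module

theorem post_scatter {v v₁ : Vel} (h : v ≠ v₁) (σ : Sph) :
    post (post v v₁ σ) (post₁ v v₁ σ) (direction (v - v₁) σ) = v := by
  have h0 : ‖v - v₁‖ ≠ 0 := by simpa [sub_eq_zero] using h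
  rw [post, norm_post_sub_post₁, post_add_post₁, direction]
  simp only [sub_eq_zero, h, if_false, smul_smul, mul_assoc, mul_inv_cancel₀ h0]
  module

/-- Microreversibility: the relative speed and the scattering angle are the same before and after
the collision. -/
theorem CollisionKernel.eval_scatter (q : CollisionKernel) {v v₁ : Vel} (h : v ≠ v₁) (σ : Sph) :
    q.eval (post v v₁ σ - post₁ v v₁ σ) (direction (v - v₁) σ) = q.eval (v - v₁) σ := by
  have h0 : 0 < ‖v - v₁‖ := by simpa [sub_eq_zero] using h
  rw [eval, eval, norm_post_sub_post₁, post_sub_post₁, direction]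
  simp only [sub_eq_zero, h, if_false]
  rw [InnerProductGeometry.angle_smul_left_of_pos _ _ h0,
    InnerProductGeometry.angle_smul_right_of_pos _ _ (inv_pos.2 h0),
    InnerProductGeometry.angle_comm]

/-- The renaming `(v, v₁, σ) ↦ (v₁, v, -σ)` of the two particles. -/
noncomputable def relabel (p : Vel × Vel × Sph) : Vel × Vel × Sph := (p.2.1, p.1, -p.2.2)

theorem measurePreserving_relabel :
    MeasurePreserving relabel collisionMeasure collisionMeasure := by
  have h1 := (measurePreserving_prodAssoc (volume : Measure Vel) (volume : Measure Vel) surf).symm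
  have h2 := (Measure.measurePreserving_swap (μ := (volume : Measure Vel))
    (ν := (volume : Measure Vel))).prod measurePreserving_neg_surf
  have h3 := measurePreserving_prodAssoc (volume : Measure Vel) (volume : Measure Vel) surf
  exact h3.comp (h2.comp h1)

theorem post₁_relabel (v v₁ : Vel) (σ : Sph) : post₁ v₁ v (-σ) = post v v₁ σ := by
  simp only [post, post₁, norm_sub_rev v₁ v, coe_neg_sphere]; module

theorem CollisionKernel.eval_relabel (q : CollisionKernel) (v v₁ : Vel) (σ : Sph) :
    q.eval (v₁ - v) (-σ) = q.eval (v - v₁) σ := by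
  rw [eval, eval, norm_sub_rev, ← neg_sub v v₁, coe_neg_sphere, InnerProductGeometry.angle_neg_neg]

theorem CollisionKernel.measurable_eval (q : CollisionKernel) :
    Measurable fun p : Vel × Sph => q.eval p.1 p.2 := by
  refine q.measurable_profile.comp (Measurable.prodMk (by fun_prop) ?_)
  exact Real.continuous_arccos.measurable.comp (f := fun p : Vel × Sph =>
    inner ℝ p.1 (p.2 : Vel) / (‖p.1‖ * ‖(p.2 : Vel)‖)) (by fun_prop)

theorem CollisionKernel.eval_nonneg (q : CollisionKernel) (z : Vel) (σ : Sph) : 0 ≤ q.eval z σ :=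
  q.profile_nonneg _ _

theorem ae_ne_collisionMeasure : ∀ᵐ p ∂collisionMeasure, p.1 ≠ p.2.1 := by
  have hs : MeasurableSet {p : Vel × Vel × Sph | p.1 ≠ p.2.1} :=
    (measurableSet_eq_fun (by fun_prop) (by fun_prop)).compl
  rw [collisionMeasure, Measure.ae_prod_iff_ae_ae hs]
  refine .of_forall fun v => ?_
  have h : ∀ᵐ v₁ : Vel, v ≠ v₁ := by
    filter_upwards [compl_mem_ae_iff.2 (measure_singleton v)] with v₁ h1 h2
    exact h1 h2.symm
  exact Measure.quasiMeasurePreserving_fst.ae h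

end Boltzmann

/-! ### Weak form of the collision operator and duality -/

namespace Boltzmann

variable {q : CollisionKernel}

theorem measurable_eval_sub (q : CollisionKernel) :
    Measurable fun p : Vel × Vel × Sph => q.eval (p.1 - p.2.1) p.2.2 :=
  q.measurable_eval.comp (f := fun p : Vel × Vel × Sph => (p.1 - p.2.1, p.2.2)) (by fun_prop)

theorem measurable_collision_param {ι : Type*} [MeasurableSpace ι] (q : CollisionKernel)
    {g h : ι → Vel → ℝ} (hg : Measurable (Function.uncurry g))
    (hh : Measurable (Function.uncurry h)) {i : ι → Vel} (hi : Measurable i) :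
    Measurable fun p : ι => collision q (g p) (h p) (i p) := by
  have hx : Measurable fun x : (ι × Vel) × Sph => (i x.1.1, x.1.2, x.2) := by fun_prop
  have hp := measurable_post.comp hx
  have hp1 := measurable_post₁.comp hx
  have hq := (measurable_eval_sub q).comp hx
  have hι : Measurable fun x : (ι × Vel) × Sph => x.1.1 := by fun_prop
  have hv : Measurable fun x : (ι × Vel) × Sph => i x.1.1 := by fun_prop
  have hv1 : Measurable fun x : (ι × Vel) × Sph => x.1.2 := by fun_prop
  have h1 := hq.mul (((hg.comp (hι.prodMk hp1)).mul (hh.comp (hι.prodMk hp))).sub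
    ((hg.comp (hι.prodMk hv1)).mul (hh.comp (hι.prodMk hv))))
  exact (h1.stronglyMeasurable.integral_prod_right (ν := surf)).integral_prod_right.measurable

theorem measurable_collision (q : CollisionKernel) {g h : Vel → ℝ} (hg : Measurable g)
    (hh : Measurable h) : Measurable fun v => collision q g h v :=
  measurable_collision_param q (g := fun _ : Vel => g) (h := fun _ : Vel => h)
      (hg.comp measurable_snd) (hh.comp measurable_snd) measurable_id

/-- An iterated integral over `ℝ³ × S²` times a function of `v` is the marginal of an integrable
function on the collision space. -/
theorem integrable_mul_iterated {u : Vel → ℝ} {F : Vel × Vel × Sph → ℝ}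
    (h : Integrable (fun p => u p.1 * F p) collisionMeasure) :
    Integrable (fun v => u v * ∫ v₁, ∫ σ, F (v, v₁, σ) ∂surf) ∧
    ∫ v, u v * ∫ v₁, ∫ σ, F (v, v₁, σ) ∂surf = ∫ p, u p.1 * F p ∂collisionMeasure := by
  unfold collisionMeasure at h ⊢
  have hae : ∀ᵐ v : Vel, ∫ y, u v * F (v, y) ∂((volume : Measure Vel).prod surf) =
      u v * ∫ v₁, ∫ σ, F (v, v₁, σ) ∂surf := by
    filter_upwards [h.prod_right_ae] with v hv
    rw [integral_prod _ hv]
    simp only [integral_const_mul]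
  refine ⟨h.integral_prod_left.congr hae, ?_⟩
  rw [integral_prod _ h]
  exact (integral_congr_ae hae).symm

theorem integrable_comp_scatter {F : Vel × Vel × Sph → ℝ} (hF : Integrable F collisionMeasure) :
    Integrable (fun p => F (scatter p)) collisionMeasure :=
  (measurePreserving_scatter.integrable_comp hF.1).2 hF

theorem integral_comp_scatter {F : Vel × Vel × Sph → ℝ} (hF : Integrable F collisionMeasure) :
    ∫ p, F (scatter p) ∂collisionMeasure = ∫ p, F p ∂collisionMeasure := by
  conv_rhs => rw [← measurePreserving_scatter.map_eq]
  rw [integral_map measurePreserving_scatter.measurable.aemeasurable]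
  rw [measurePreserving_scatter.map_eq]
  exact hF.1

theorem integral_comp_relabel {F : Vel × Vel × Sph → ℝ} (hF : Integrable F collisionMeasure) :
    ∫ p, F (relabel p) ∂collisionMeasure = ∫ p, F p ∂collisionMeasure := by
  conv_rhs => rw [← measurePreserving_relabel.map_eq]
  rw [integral_map measurePreserving_relabel.measurable.aemeasurable]
  rw [measurePreserving_relabel.map_eq]
  exact hF.1

/-- The weak form of the collision operator: the gain term is carried over to the test function
by the change of variables `scatter`. -/
theorem collision_weak {g h φ : Vel → ℝ}
    (hpost : Integrable (fun p : Vel × Vel × Sph =>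
      q.eval (p.1 - p.2.1) p.2.2 * (g p.2.1 * h p.1 * φ (post p.1 p.2.1 p.2.2))) collisionMeasure)
    (hpre : Integrable (fun p : Vel × Vel × Sph =>
      q.eval (p.1 - p.2.1) p.2.2 * (g p.2.1 * h p.1 * φ p.1)) collisionMeasure) :
    Integrable (fun v => φ v * collision q g h v) ∧
    ∫ v, φ v * collision q g h v =
      ∫ p, q.eval (p.1 - p.2.1) p.2.2 * (g p.2.1 * h p.1 * φ (post p.1 p.2.1 p.2.2)) -
        q.eval (p.1 - p.2.1) p.2.2 * (g p.2.1 * h p.1 * φ p.1) ∂collisionMeasure := by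
  -- The gain term of `φ Q(g, h)` is the integrand with `φ'`, composed with `scatter`.
  have hae : (fun p => q.eval ((scatter p).1 - (scatter p).2.1) (scatter p).2.2 *
        (g (scatter p).2.1 * h (scatter p).1 *
          φ (post (scatter p).1 (scatter p).2.1 (scatter p).2.2)) -
        q.eval (p.1 - p.2.1) p.2.2 * (g p.2.1 * h p.1 * φ p.1)) =ᵐ[collisionMeasure]
      fun p => φ p.1 * (q.eval (p.1 - p.2.1) p.2.2 *
        (g (post₁ p.1 p.2.1 p.2.2) * h (post p.1 p.2.1 p.2.2) - g p.2.1 * h p.1)) := by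
    filter_upwards [ae_ne_collisionMeasure] with p hp
    simp only [scatter, post_scatter hp, q.eval_scatter hp]
    ring
  have hgain := integrable_comp_scatter hpost
  have hint := (hgain.sub hpre).congr hae
  obtain ⟨h1, h2⟩ := integrable_mul_iterated (u := φ)
    (F := fun p => q.eval (p.1 - p.2.1) p.2.2 *
        (g (post₁ p.1 p.2.1 p.2.2) * h (post p.1 p.2.1 p.2.2) - g p.2.1 * h p.1)) hint
  refine ⟨h1, ?_⟩
  unfold collision
  rw [h2, ← integral_congr_ae hae, integral_sub hgain hpre, integral_sub hpost hpre,
    integral_comp_scatter hpost]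

/-- The duality between the linearized collision operator and `L*[f]`, written for `u = f ψ`. The
term with `Q(u, f)` is brought to the form of the others by relabelling the particles. -/
theorem linearizedAdjoint_duality {f u φ : Vel → ℝ}
    (hpre : Integrable (fun p : Vel × Vel × Sph =>
      q.eval (p.1 - p.2.1) p.2.2 * (f p.2.1 * u p.1 * φ p.1)) collisionMeasure)
    (hpre₁ : Integrable (fun p : Vel × Vel × Sph =>
      q.eval (p.1 - p.2.1) p.2.2 * (f p.2.1 * u p.1 * φ p.2.1)) collisionMeasure)
    (hpost : Integrable (fun p : Vel × Vel × Sph =>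
      q.eval (p.1 - p.2.1) p.2.2 * (f p.2.1 * u p.1 * φ (post p.1 p.2.1 p.2.2))) collisionMeasure)
    (hpost₁ : Integrable (fun p : Vel × Vel × Sph =>
      q.eval (p.1 - p.2.1) p.2.2 * (f p.2.1 * u p.1 * φ (post₁ p.1 p.2.1 p.2.2)))
        collisionMeasure) :
    Integrable (fun v => φ v * collision q f u v) ∧
    Integrable (fun v => φ v * collision q u f v) ∧
    Integrable (fun v => u v * linearizedAdjoint q f φ v) ∧
    (∫ v, φ v * collision q f u v) + ∫ v, φ v * collision q u f v =
      ∫ v, u v * linearizedAdjoint q f φ v := by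
  obtain ⟨h1, e1⟩ := collision_weak hpost hpre
  -- Relabelling turns the integrands with `φ₁'` and `φ₁` into those of the weak form of `Q(u, f)`.
  have hpost' : Integrable (fun p : Vel × Vel × Sph =>
      q.eval (p.1 - p.2.1) p.2.2 * (u p.2.1 * f p.1 * φ (post p.1 p.2.1 p.2.2)))
        collisionMeasure := by
    refine ((measurePreserving_relabel.integrable_comp hpost₁.1).2 hpost₁).congr
      (.of_forall fun p => ?_)
    simp only [Function.comp, relabel, q.eval_relabel, post₁_relabel]
    ring
  have hpre' : Integrable (fun p : Vel × Vel × Sph =>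
      q.eval (p.1 - p.2.1) p.2.2 * (u p.2.1 * f p.1 * φ p.1)) collisionMeasure := by
    refine ((measurePreserving_relabel.integrable_comp hpre₁.1).2 hpre₁).congr
      (.of_forall fun p => ?_)
    simp only [Function.comp, relabel, q.eval_relabel]
    ring
  obtain ⟨h2, e2⟩ := collision_weak hpost' hpre'
  have hL := ((hpost.add hpost₁).sub hpre).sub hpre₁
  have hae : (fun p : Vel × Vel × Sph => u p.1 * (f p.2.1 *
      (φ (post p.1 p.2.1 p.2.2) + φ (post₁ p.1 p.2.1 p.2.2) - φ p.1 - φ p.2.1) *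
      q.eval (p.1 - p.2.1) p.2.2)) = fun p =>
      q.eval (p.1 - p.2.1) p.2.2 * (f p.2.1 * u p.1 * φ (post p.1 p.2.1 p.2.2)) +
      q.eval (p.1 - p.2.1) p.2.2 * (f p.2.1 * u p.1 * φ (post₁ p.1 p.2.1 p.2.2)) -
      q.eval (p.1 - p.2.1) p.2.2 * (f p.2.1 * u p.1 * φ p.1) -
      q.eval (p.1 - p.2.1) p.2.2 * (f p.2.1 * u p.1 * φ p.2.1) := by
    funext p
    ring
  obtain ⟨h3, e3⟩ := integrable_mul_iterated (u := u) (F := fun p => f p.2.1 *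
      (φ (post p.1 p.2.1 p.2.2) + φ (post₁ p.1 p.2.1 p.2.2) - φ p.1 - φ p.2.1) *
      q.eval (p.1 - p.2.1) p.2.2) (by rw [hae]; exact hL)
  refine ⟨h1, h2, h3, ?_⟩
  have e3' : ∫ v, u v * linearizedAdjoint q f φ v = _ := e3
  have e4 : ∫ p : Vel × Vel × Sph,
      (q.eval (p.1 - p.2.1) p.2.2 * (u p.2.1 * f p.1 * φ (post p.1 p.2.1 p.2.2)) -
        q.eval (p.1 - p.2.1) p.2.2 * (u p.2.1 * f p.1 * φ p.1)) ∂collisionMeasure =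
      ∫ p, (q.eval (p.1 - p.2.1) p.2.2 * (f p.2.1 * u p.1 * φ (post₁ p.1 p.2.1 p.2.2)) -
        q.eval (p.1 - p.2.1) p.2.2 * (f p.2.1 * u p.1 * φ p.2.1)) ∂collisionMeasure := by
    refine Eq.trans ?_ (integral_comp_relabel (hpost₁.sub hpre₁))
    refine integral_congr_ae (.of_forall fun p => ?_)
    simp only [relabel, q.eval_relabel, post₁_relabel]
    ring
  rw [e3', e1, e2, e4, hae]
  refine (integral_add (hpost.sub hpre) (hpost₁.sub hpre₁)).symm.trans ?_
  refine integral_congr_ae (.of_forall fun p => ?_)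
  simp only [Pi.sub_apply]
  ring

theorem isAdjointPair (q : CollisionKernel) {f : Vel → ℝ} (hf : ∀ᵐ v, 0 < f v) :
    IsAdjointPair q f := by
  intro ψ φ _ _ H
  have key {c : Vel × Vel × Sph → ℝ} (h : Integrable (fun p : Vel × Vel × Sph =>
      q.eval (p.1 - p.2.1) p.2.2 * (f p.1 * f p.2.1 * ψ p.1 * c p)) collisionMeasure) :
      Integrable (fun p : Vel × Vel × Sph =>
        q.eval (p.1 - p.2.1) p.2.2 * (f p.2.1 * (f p.1 * ψ p.1) * c p)) collisionMeasure :=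
    h.congr (.of_forall fun p => by ring)
  obtain ⟨h1, h2, h3, e⟩ := linearizedAdjoint_duality (u := fun v => f v * ψ v) (key H.pre)
    (key H.pre₁) (key H.post) (key H.post₁)
  -- Positivity of `f` serves only to cancel the factor `f⁻¹` of `L[f]`.
  have hL : (fun v => φ v * collision q f (fun w => f w * ψ w) v +
      φ v * collision q (fun w => f w * ψ w) f v) =ᵐ[volume]
      fun v => linearized q f ψ v * φ v * f v := by
    filter_upwards [hf] with v hv
    simp only [linearized]
    field_simp
  have hR : (fun v => f v * ψ v * linearizedAdjoint q f φ v) =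
      fun v => ψ v * linearizedAdjoint q f φ v * f v := by
    funext v; ring
  refine ⟨(h1.add h2).congr hL, hR ▸ h3, ?_⟩
  rw [← integral_congr_ae hL, integral_add h1 h2, e, hR]

end Boltzmann

/-! ### Estimates in weighted spaces -/

namespace Boltzmann

variable {q : CollisionKernel} {k : ℝ}

theorem weight_pos (k : ℝ) (v : Vel) : 0 < weight k v := by unfold weight; positivity

theorem measurable_weight (k : ℝ) : Measurable (weight k) := by unfold weight; fun_prop

/-- Conservation of kinetic energy. -/
theorem norm_sq_post_add_norm_sq_post₁ (v v₁ : Vel) (σ : Sph) :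
    ‖post v v₁ σ‖ ^ 2 + ‖post₁ v v₁ σ‖ ^ 2 = ‖v‖ ^ 2 + ‖v₁‖ ^ 2 := by
  have h1 := parallelogram_law_with_norm ℝ ((1 / 2 : ℝ) • (v + v₁))
    ((1 / 2 * ‖v - v₁‖) • (σ : Vel))
  have h2 := parallelogram_law_with_norm ℝ v v₁
  simp only [norm_smul, norm_eq_of_mem_sphere, norm_mul, norm_norm,
    show ‖(1 / 2 : ℝ)‖ = 1 / 2 by norm_num] at h1
  unfold post post₁
  linarith

theorem weight_le_mul_of_sq_le (hk : 0 ≤ k) {u v v₁ : Vel} (h : ‖u‖ ^ 2 ≤ ‖v‖ ^ 2 + ‖v₁‖ ^ 2) :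
    weight k u ≤ weight k v * weight k v₁ := by
  unfold weight
  rw [← Real.mul_rpow (by positivity) (by positivity)]
  refine Real.rpow_le_rpow (by positivity) ?_ (by positivity)
  nlinarith [mul_nonneg (sq_nonneg ‖v‖) (sq_nonneg ‖v₁‖)]

theorem weight_post_le (hk : 0 ≤ k) (v v₁ : Vel) (σ : Sph) :
    weight k (post v v₁ σ) ≤ weight k v * weight k v₁ :=
  weight_le_mul_of_sq_le hk (by
    linarith [norm_sq_post_add_norm_sq_post₁ v v₁ σ, sq_nonneg ‖post₁ v v₁ σ‖])

theorem weight_post₁_le (hk : 0 ≤ k) (v v₁ : Vel) (σ : Sph) :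
    weight k (post₁ v v₁ σ) ≤ weight k v * weight k v₁ :=
  weight_le_mul_of_sq_le hk (by
    linarith [norm_sq_post_add_norm_sq_post₁ v v₁ σ, sq_nonneg ‖post v v₁ σ‖])

theorem weight_left_le (hk : 0 ≤ k) (v v₁ : Vel) : weight k v ≤ weight k v * weight k v₁ :=
  weight_le_mul_of_sq_le hk (by linarith [sq_nonneg ‖v₁‖])

theorem weight_right_le (hk : 0 ≤ k) (v v₁ : Vel) : weight k v₁ ≤ weight k v * weight k v₁ :=
  weight_le_mul_of_sq_le hk (by linarith [sq_nonneg ‖v‖])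

/-- Measurable functions in the weighted Lebesgue space `L¹_k`. -/
structure MemL1 (k : ℝ) (g : Vel → ℝ) : Prop where
  measurable : Measurable g
  integrable : Integrable fun v => weight k v * g v

/-- The norm `∫ |g| (1 + |v|²)^(k/2) dv` of `L¹_k`. -/
noncomputable def wnorm (k : ℝ) (g : Vel → ℝ) : ℝ := ∫ v, weight k v * |g v|

/-- Measurable test functions `φ` with `|φ(v)| ≤ C (1 + |v|²)^(k/2)`. -/
structure IsTest (k C : ℝ) (φ : Vel → ℝ) : Prop where
  measurable : Measurable φ
  bound : ∀ v, |φ v| ≤ C * weight k v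

theorem MemL1.sub {g h : Vel → ℝ} (hg : MemL1 k g) (hh : MemL1 k h) :
    MemL1 k fun v => g v - h v :=
  ⟨hg.measurable.sub hh.measurable,
    (hg.integrable.sub hh.integrable).congr (.of_forall fun v => by simp [mul_sub])⟩

theorem MemL1.const_mul {g : Vel → ℝ} (hg : MemL1 k g) (c : ℝ) : MemL1 k fun v => c * g v :=
  ⟨hg.measurable.const_mul c,
    (hg.integrable.const_mul c).congr (.of_forall fun v => by ring)⟩

theorem memL1_zero (k : ℝ) : MemL1 k fun _ => 0 := ⟨measurable_const, by simp⟩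

theorem MemL1.integrable_abs {g : Vel → ℝ} (hg : MemL1 k g) :
    Integrable fun v => weight k v * |g v| :=
  hg.integrable.abs.congr (.of_forall fun v => by simp [abs_mul, abs_of_pos (weight_pos k v)])

theorem wnorm_nonneg (k : ℝ) (g : Vel → ℝ) : 0 ≤ wnorm k g :=
  integral_nonneg fun v => mul_nonneg (weight_pos k v).le (abs_nonneg _)

theorem IsTest.nonneg {C : ℝ} {φ : Vel → ℝ} (h : IsTest k C φ) : 0 ≤ C :=
  nonneg_of_mul_nonneg_left ((abs_nonneg _).trans (h.bound 0)) (weight_pos k 0)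

theorem MemL1.integrable_mul {C : ℝ} {φ g : Vel → ℝ} (hg : MemL1 k g) (h : IsTest k C φ) :
    Integrable fun v => φ v * g v := by
  refine (hg.integrable_abs.const_mul C).mono' (h.measurable.mul hg.measurable).aestronglyMeasurable
    (.of_forall fun v => ?_)
  rw [Real.norm_eq_abs, abs_mul, ← mul_assoc]
  exact mul_le_mul_of_nonneg_right (h.bound v) (abs_nonneg _)

theorem MemL1.abs_integral_mul_le {C : ℝ} {φ g : Vel → ℝ} (hg : MemL1 k g) (h : IsTest k C φ) :
    |∫ v, φ v * g v| ≤ C * wnorm k g := by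
  rw [wnorm, ← integral_const_mul]
  refine norm_integral_le_of_norm_le (f := fun v => φ v * g v) (hg.integrable_abs.const_mul C)
    (.of_forall fun v => ?_)
  rw [Real.norm_eq_abs, abs_mul, ← mul_assoc]
  exact mul_le_mul_of_nonneg_right (h.bound v) (abs_nonneg _)

/-- `Λ` bounds the total collision rate `∫ q(z, σ) dσ` uniformly in `z`. -/
def CollisionKernel.RateBound (q : CollisionKernel) (Λ : ℝ) : Prop :=
  0 ≤ Λ ∧ ∀ z : Vel, Integrable (q.eval z) surf ∧ ∫ σ, q.eval z σ ∂surf ≤ Λ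

theorem CollisionKernel.IsCutoff.exists_rateBound (h : q.IsCutoff) : ∃ Λ : ℝ, q.RateBound Λ := by
  obtain ⟨Λ, hΛ⟩ := h
  refine ⟨Λ, Λ.2, fun z => ?_⟩
  have hm : AEStronglyMeasurable (q.eval z) surf :=
    (q.measurable_eval.comp measurable_prodMk_left).aestronglyMeasurable
  have h0 : 0 ≤ᵐ[surf] q.eval z := .of_forall fun σ => q.eval_nonneg z σ
  constructor
  · refine (lintegral_ofReal_ne_top_iff_integrable hm h0).1 ?_
    exact ((hΛ z).trans_lt ENNReal.coe_lt_top).ne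
  · rw [integral_eq_lintegral_of_nonneg_ae h0 hm]
    exact ENNReal.toReal_le_coe_of_le_coe (hΛ z)

variable {Λ : ℝ}

/-- With a bounded collision rate, integrating out `σ` and `v₁` costs at most a factor `Λ`. -/
theorem integrable_rate_section (hq : q.RateBound Λ) (v : Vel) {G : Vel → ℝ} (hG : Integrable G)
    (hG0 : ∀ v, 0 ≤ G v) :
    Integrable (fun y : Vel × Sph => G y.1 * q.eval (v - y.1) y.2) (volume.prod surf) ∧
    ∫ y, G y.1 * q.eval (v - y.1) y.2 ∂((volume : Measure Vel).prod surf) ≤ Λ * ∫ v, G v := by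
  have hm : Measurable fun y : Vel × Sph => q.eval (v - y.1) y.2 :=
    q.measurable_eval.comp (f := fun y : Vel × Sph => (v - y.1, y.2)) (by fun_prop)
  have hr : Measurable fun v₁ : Vel => ∫ σ, q.eval (v - v₁) σ ∂surf :=
    hm.stronglyMeasurable.integral_prod_right'.measurable
  have hr0 (v₁ : Vel) : 0 ≤ ∫ σ, q.eval (v - v₁) σ ∂surf :=
    integral_nonneg fun σ => q.eval_nonneg _ _
  have hb : Integrable fun v₁ : Vel => G v₁ * ∫ σ, q.eval (v - v₁) σ ∂surf :=
    hG.mul_bdd hr.aestronglyMeasurable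
      (.of_forall fun v₁ => by rw [Real.norm_of_nonneg (hr0 v₁)]; exact (hq.2 _).2)
  have hint : Integrable (fun y : Vel × Sph => G y.1 * q.eval (v - y.1) y.2)
      (volume.prod surf) := by
    refine (integrable_prod_iff (hG.1.comp_fst.mul hm.aestronglyMeasurable)).2
      ⟨.of_forall fun v₁ => (hq.2 (v - v₁)).1.const_mul (G v₁), hb.congr (.of_forall fun v₁ => ?_)⟩
    simp only [Pi.mul_apply, norm_mul, Real.norm_of_nonneg (hG0 _),
      Real.norm_of_nonneg (q.eval_nonneg _ _), integral_const_mul]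
  refine ⟨hint, ?_⟩
  rw [integral_prod _ hint, mul_comm Λ, ← integral_mul_const]
  simp only [integral_const_mul]
  exact integral_mono hb (hG.mul_const Λ) fun v₁ =>
    mul_le_mul_of_nonneg_left (hq.2 _).2 (hG0 v₁)

theorem integrable_rate (hq : q.RateBound Λ) {G H : Vel → ℝ} (hG : Integrable G)
    (hG0 : ∀ v, 0 ≤ G v) (hH : Integrable H) (hH0 : ∀ v, 0 ≤ H v) :
    Integrable (fun p : Vel × Vel × Sph => H p.1 * (G p.2.1 * q.eval (p.1 - p.2.1) p.2.2))
      collisionMeasure ∧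
    ∫ p, H p.1 * (G p.2.1 * q.eval (p.1 - p.2.1) p.2.2) ∂collisionMeasure ≤
      Λ * (∫ v, G v) * ∫ v, H v := by
  unfold collisionMeasure
  have hm : AEStronglyMeasurable
      (fun p : Vel × Vel × Sph => G p.2.1 * q.eval (p.1 - p.2.1) p.2.2)
      (volume.prod (volume.prod surf)) :=
    (hG.1.comp_fst.comp_snd).mul (measurable_eval_sub q).aestronglyMeasurable
  have hr : AEStronglyMeasurable (fun v : Vel =>
      ∫ y, G y.1 * q.eval (v - y.1) y.2 ∂((volume : Measure Vel).prod surf)) volume :=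
    hm.integral_prod_right'
  have hr0 (v : Vel) : 0 ≤ ∫ y, G y.1 * q.eval (v - y.1) y.2 ∂((volume : Measure Vel).prod surf) :=
    integral_nonneg fun y => mul_nonneg (hG0 _) (q.eval_nonneg _ _)
  have hb : Integrable fun v : Vel =>
      H v * ∫ y, G y.1 * q.eval (v - y.1) y.2 ∂((volume : Measure Vel).prod surf) :=
    hH.mul_bdd hr (.of_forall fun v => by
      rw [Real.norm_of_nonneg (hr0 v)]; exact (integrable_rate_section hq v hG hG0).2)
  have hint : Integrable (fun p : Vel × Vel × Sph =>
      H p.1 * (G p.2.1 * q.eval (p.1 - p.2.1) p.2.2)) (volume.prod (volume.prod surf)) := by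
    refine (integrable_prod_iff (hH.1.comp_fst.mul hm)).2
      ⟨.of_forall fun v => (integrable_rate_section hq v hG hG0).1.const_mul (H v),
        hb.congr (.of_forall fun v => ?_)⟩
    simp only [Pi.mul_apply, norm_mul, Real.norm_of_nonneg (hG0 _), Real.norm_of_nonneg (hH0 _),
      Real.norm_of_nonneg (q.eval_nonneg _ _), integral_const_mul]
  refine ⟨hint, ?_⟩
  rw [integral_prod _ hint, mul_comm, ← integral_mul_const]
  simp only [integral_const_mul]
  exact integral_mono hb (hH.mul_const _) fun v =>
    mul_le_mul_of_nonneg_left (integrable_rate_section hq v hG hG0).2 (hH0 v)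

/-- The trilinear integrals of the weak formulation converge for `g, h` in `L¹_k` and a factor
`c(v, v₁, σ)` of growth at most that of the product of the weights. -/
theorem integrable_trilinear (hq : q.RateBound Λ) {C : ℝ} {g h : Vel → ℝ} (hg : MemL1 k g)
    (hh : MemL1 k h) {c : Vel × Vel × Sph → ℝ} (hc : Measurable c)
    (hcb : ∀ p, |c p| ≤ C * (weight k p.1 * weight k p.2.1)) :
    Integrable (fun p => q.eval (p.1 - p.2.1) p.2.2 * (g p.2.1 * h p.1 * c p))
      collisionMeasure ∧
    |∫ p, q.eval (p.1 - p.2.1) p.2.2 * (g p.2.1 * h p.1 * c p) ∂collisionMeasure| ≤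
      C * Λ * wnorm k g * wnorm k h := by
  have hC : 0 ≤ C := nonneg_of_mul_nonneg_left ((abs_nonneg _).trans (hcb
      (0, 0, ⟨EuclideanSpace.single 0 1, by simp⟩))) (mul_pos (weight_pos k _) (weight_pos k _))
  obtain ⟨h1, h2⟩ := integrable_rate hq hg.integrable_abs
    (fun v => mul_nonneg (weight_pos k v).le (abs_nonneg _)) hh.integrable_abs
    (fun v => mul_nonneg (weight_pos k v).le (abs_nonneg _))
  have hle : ∀ p : Vel × Vel × Sph, ‖q.eval (p.1 - p.2.1) p.2.2 * (g p.2.1 * h p.1 * c p)‖ ≤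
      C * (weight k p.1 * |h p.1| *
        (weight k p.2.1 * |g p.2.1| * q.eval (p.1 - p.2.1) p.2.2)) := by
    intro p
    rw [Real.norm_eq_abs, abs_mul, abs_mul, abs_mul, abs_of_nonneg (q.eval_nonneg _ _)]
    calc q.eval (p.1 - p.2.1) p.2.2 * (|g p.2.1| * |h p.1| * |c p|)
        ≤ q.eval (p.1 - p.2.1) p.2.2 * (|g p.2.1| * |h p.1| *
            (C * (weight k p.1 * weight k p.2.1))) := by
          have := q.eval_nonneg (p.1 - p.2.1) p.2.2
          have := hcb p
          gcongr
      _ = _ := by ring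
  have hmeas : Measurable fun p : Vel × Vel × Sph =>
      q.eval (p.1 - p.2.1) p.2.2 * (g p.2.1 * h p.1 * c p) :=
    (measurable_eval_sub q).mul (((hg.measurable.comp (by fun_prop)).mul
      (hh.measurable.comp (by fun_prop))).mul hc)
  refine ⟨(h1.const_mul C).mono' hmeas.aestronglyMeasurable (.of_forall hle), ?_⟩
  refine (norm_integral_le_of_norm_le (h1.const_mul C) (.of_forall hle)).trans ?_
  rw [integral_const_mul]
  refine (mul_le_mul_of_nonneg_left h2 hC).trans_eq ?_
  simp only [wnorm]
  ring

section Weak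

variable {C : ℝ} {f g h u φ : Vel → ℝ}

theorem IsTest.measurable_post (hφ : IsTest k C φ) :
    Measurable fun p : Vel × Vel × Sph => φ (post p.1 p.2.1 p.2.2) :=
  hφ.measurable.comp Boltzmann.measurable_post

theorem IsTest.measurable_post₁ (hφ : IsTest k C φ) :
    Measurable fun p : Vel × Vel × Sph => φ (post₁ p.1 p.2.1 p.2.2) :=
  hφ.measurable.comp Boltzmann.measurable_post₁

theorem IsTest.abs_post_le (hφ : IsTest k C φ) (hk : 0 ≤ k) (v v₁ : Vel) (σ : Sph) :
    |φ (post v v₁ σ)| ≤ C * (weight k v * weight k v₁) :=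
  (hφ.bound _).trans (mul_le_mul_of_nonneg_left (weight_post_le hk _ _ _) hφ.nonneg)

theorem IsTest.abs_post₁_le (hφ : IsTest k C φ) (hk : 0 ≤ k) (v v₁ : Vel) (σ : Sph) :
    |φ (post₁ v v₁ σ)| ≤ C * (weight k v * weight k v₁) :=
  (hφ.bound _).trans (mul_le_mul_of_nonneg_left (weight_post₁_le hk _ _ _) hφ.nonneg)

theorem IsTest.abs_left_le (hφ : IsTest k C φ) (hk : 0 ≤ k) (v v₁ : Vel) :
    |φ v| ≤ C * (weight k v * weight k v₁) :=
  (hφ.bound _).trans (mul_le_mul_of_nonneg_left (weight_left_le hk _ _) hφ.nonneg)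

theorem IsTest.abs_right_le (hφ : IsTest k C φ) (hk : 0 ≤ k) (v v₁ : Vel) :
    |φ v₁| ≤ C * (weight k v * weight k v₁) :=
  (hφ.bound _).trans (mul_le_mul_of_nonneg_left (weight_right_le hk _ _) hφ.nonneg)

theorem integrable_gain_sub_loss (hk : 0 ≤ k) (hq : q.RateBound Λ) (hg : MemL1 k g)
    (hh : MemL1 k h) (hφ : IsTest k C φ) :
    Integrable (fun p : Vel × Vel × Sph => q.eval (p.1 - p.2.1) p.2.2 *
      (g p.2.1 * h p.1 * (φ (post p.1 p.2.1 p.2.2) - φ p.1))) collisionMeasure ∧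
    |∫ p, q.eval (p.1 - p.2.1) p.2.2 *
      (g p.2.1 * h p.1 * (φ (post p.1 p.2.1 p.2.2) - φ p.1)) ∂collisionMeasure| ≤
      2 * C * Λ * wnorm k g * wnorm k h := by
  refine integrable_trilinear hq hg hh
    (hφ.measurable_post.sub (hφ.measurable.comp measurable_fst)) fun p => ?_
  refine (abs_sub _ _).trans ?_
  linarith [hφ.abs_post_le hk p.1 p.2.1 p.2.2, hφ.abs_left_le hk p.1 p.2.1]

theorem integral_mul_collision (hk : 0 ≤ k) (hq : q.RateBound Λ) (hg : MemL1 k g)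
    (hh : MemL1 k h) (hφ : IsTest k C φ) :
    Integrable (fun v => φ v * collision q g h v) ∧
    ∫ v, φ v * collision q g h v = ∫ p, q.eval (p.1 - p.2.1) p.2.2 *
      (g p.2.1 * h p.1 * (φ (post p.1 p.2.1 p.2.2) - φ p.1)) ∂collisionMeasure := by
  obtain ⟨h1, h2⟩ := collision_weak (q := q) (g := g) (h := h) (φ := φ)
    (integrable_trilinear hq hg hh hφ.measurable_post
      fun p => hφ.abs_post_le hk p.1 p.2.1 p.2.2).1
    (integrable_trilinear hq hg hh (hφ.measurable.comp measurable_fst)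
      fun p => hφ.abs_left_le hk p.1 p.2.1).1
  refine ⟨h1, h2.trans (integral_congr_ae (.of_forall fun p => ?_))⟩
  ring

theorem integral_mul_linearizedAdjoint (hk : 0 ≤ k) (hq : q.RateBound Λ) (hf : MemL1 k f)
    (hu : MemL1 k u) (hφ : IsTest k C φ) :
    (∫ v, φ v * collision q f u v) + ∫ v, φ v * collision q u f v =
      ∫ v, u v * linearizedAdjoint q f φ v :=
  (linearizedAdjoint_duality
    (integrable_trilinear hq hf hu (hφ.measurable.comp measurable_fst)
      fun p => hφ.abs_left_le hk p.1 p.2.1).1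
    (integrable_trilinear hq hf hu (hφ.measurable.comp (by fun_prop))
      fun p => hφ.abs_right_le hk p.1 p.2.1).1
    (integrable_trilinear hq hf hu hφ.measurable_post
      fun p => hφ.abs_post_le hk p.1 p.2.1 p.2.2).1
    (integrable_trilinear hq hf hu hφ.measurable_post₁
      fun p => hφ.abs_post₁_le hk p.1 p.2.1 p.2.2).1).2.2.2

theorem isTest_weight_mul_sign {D : Vel → ℝ} (hD : Measurable D) :
    IsTest k 1 fun v => weight k v * (SignType.sign (D v) : ℝ) := by
  refine ⟨(measurable_weight k).mul ?_, fun v => ?_⟩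
  · have : (fun v => ((SignType.sign (D v) : SignType) : ℝ)) =
        fun v => if 0 < D v then 1 else if D v < 0 then -1 else 0 := by
      funext v
      rw [sign_apply]; split_ifs <;> simp
    rw [this]
    exact Measurable.ite (measurableSet_lt measurable_const hD) measurable_const
      (Measurable.ite (measurableSet_lt hD measurable_const) measurable_const measurable_const)
  · rw [abs_mul, abs_of_pos (weight_pos k v), one_mul]
    refine mul_le_of_le_one_right (weight_pos k v).le ?_
    rcases lt_trichotomy (D v) 0 with h | h | h <;> simp [h]

theorem weight_mul_sign_mul_self (D : Vel → ℝ) (v : Vel) :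
    weight k v * (SignType.sign (D v) : ℝ) * D v = weight k v * |D v| := by
  rw [mul_assoc, sign_mul_self]

theorem memL1_collision (hk : 0 ≤ k) (hq : q.RateBound Λ) (hg : MemL1 k g) (hh : MemL1 k h) :
    MemL1 k fun v => collision q g h v := by
  refine ⟨measurable_collision q hg.measurable hh.measurable, ?_⟩
  exact (integral_mul_collision hk hq hg hh
    (⟨measurable_weight k, fun v => by rw [abs_of_pos (weight_pos k v), one_mul]⟩ :
      IsTest k 1 (weight k))).1

/-- The collision operator is locally Lipschitz on `L¹_k`. The norm of the difference is its
integral against the test function `w sign(Q(g, g) - Q(h, h))`. -/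
theorem wnorm_collision_sub_le (hk : 0 ≤ k) (hq : q.RateBound Λ) (hg : MemL1 k g)
    (hh : MemL1 k h) :
    wnorm k (fun v => collision q g g v - collision q h h v) ≤
      2 * Λ * (2 * wnorm k h + wnorm k fun v => g v - h v) * wnorm k fun v => g v - h v := by
  have hφ := isTest_weight_mul_sign (k := k) (D := fun v => collision q g g v - collision q h h v)
    ((memL1_collision hk hq hg hg).sub (memL1_collision hk hq hh hh)).measurable
  set φ : Vel → ℝ := fun v =>
    weight k v * (SignType.sign (collision q g g v - collision q h h v) : ℝ) with hφd
  have hd := hg.sub hh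
  obtain ⟨i1, e1⟩ := integral_mul_collision hk hq hg hg hφ
  obtain ⟨i2, e2⟩ := integral_mul_collision hk hq hh hh hφ
  obtain ⟨j1, b1⟩ := integrable_gain_sub_loss hk hq hh hd hφ
  obtain ⟨j2, b2⟩ := integrable_gain_sub_loss hk hq hd hh hφ
  obtain ⟨j3, b3⟩ := integrable_gain_sub_loss hk hq hd hd hφ
  have hE : wnorm k (fun v => collision q g g v - collision q h h v) =
      ∫ v, φ v * collision q g g v - φ v * collision q h h v := by
    refine integral_congr_ae (.of_forall fun v => ?_)
    refine (weight_mul_sign_mul_self (fun v => collision q g g v - collision q h h v) v).symm.trans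
      (mul_sub _ _ _)
  rw [hE, integral_sub i1 i2, e1, e2,
    ← integral_sub (integrable_gain_sub_loss hk hq hg hg hφ).1
      (integrable_gain_sub_loss hk hq hh hh hφ).1]
  have hsplit : ∀ p : Vel × Vel × Sph, q.eval (p.1 - p.2.1) p.2.2 *
      (g p.2.1 * g p.1 * (φ (post p.1 p.2.1 p.2.2) - φ p.1)) - q.eval (p.1 - p.2.1) p.2.2 *
      (h p.2.1 * h p.1 * (φ (post p.1 p.2.1 p.2.2) - φ p.1)) =
      q.eval (p.1 - p.2.1) p.2.2 *
        (h p.2.1 * (g p.1 - h p.1) * (φ (post p.1 p.2.1 p.2.2) - φ p.1)) +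
      q.eval (p.1 - p.2.1) p.2.2 *
        ((g p.2.1 - h p.2.1) * h p.1 * (φ (post p.1 p.2.1 p.2.2) - φ p.1)) +
      q.eval (p.1 - p.2.1) p.2.2 *
        ((g p.2.1 - h p.2.1) * (g p.1 - h p.1) * (φ (post p.1 p.2.1 p.2.2) - φ p.1)) :=
    fun p => by ring
  simp only [hsplit]
  refine ((integral_add (j1.add j2) j3).trans
    (congrArg (· + _) (integral_add j1 j2))).trans_le ?_
  have := (le_abs_self _).trans b1
  have := (le_abs_self _).trans b2
  have := (le_abs_self _).trans b3
  nlinarith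

theorem wnorm_collision_le (hk : 0 ≤ k) (hq : q.RateBound Λ) (hg : MemL1 k g) :
    wnorm k (fun v => collision q g g v) ≤ 2 * Λ * wnorm k g ^ 2 := by
  have h := wnorm_collision_sub_le hk hq hg (memL1_zero k)
  have h0 : wnorm k (fun _ => 0) = 0 := by simp [wnorm]
  have h1 (v : Vel) : collision q (fun _ => 0) (fun _ => 0) v = 0 := by simp [collision]
  simp only [h0, h1, sub_zero] at h
  linarith

/-- The collision operator against a test function differs from its linearization at `f`, tested
through `L*[f]`, by a term quadratic in the perturbation. -/
theorem abs_collision_sub_linearization_le (hk : 0 ≤ k) (hq : q.RateBound Λ) (hg : MemL1 k g)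
    (hf : MemL1 k f) (hφ : IsTest k C φ) :
    |(∫ v, φ v * (collision q g g v - collision q f f v)) -
      ∫ v, (g v - f v) * linearizedAdjoint q f φ v| ≤
      2 * C * Λ * (wnorm k fun v => g v - f v) ^ 2 := by
  have hd := hg.sub hf
  obtain ⟨i1, e1⟩ := integral_mul_collision hk hq hg hg hφ
  obtain ⟨i2, e2⟩ := integral_mul_collision hk hq hf hf hφ
  obtain ⟨i3, e3⟩ := integral_mul_collision hk hq hf hd hφ
  obtain ⟨i4, e4⟩ := integral_mul_collision hk hq hd hf hφ
  obtain ⟨j3, b3⟩ := integrable_gain_sub_loss hk hq hd hd hφ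
  have j1 := (integrable_gain_sub_loss hk hq hg hg hφ).1
  have j2 := (integrable_gain_sub_loss hk hq hf hf hφ).1
  have j4 := (integrable_gain_sub_loss hk hq hf hd hφ).1
  have j5 := (integrable_gain_sub_loss hk hq hd hf hφ).1
  simp only [mul_sub (φ _)]
  rw [← integral_mul_linearizedAdjoint hk hq hf hd hφ, integral_sub i1 i2, e1, e2, e3, e4,
    ← integral_sub j1 j2, ← integral_add j4 j5]
  refine Eq.trans_le ?_ (b3.trans_eq (by ring))
  congr 1
  refine (integral_sub (j1.sub j2) (j4.add j5)).symm.trans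
    (integral_congr_ae (.of_forall fun p => ?_))
  simp only [Pi.sub_apply, Pi.add_apply]
  ring

end Weak

end Boltzmann

/-! ### Solutions as curves in the weighted Lebesgue space -/

namespace Boltzmann

variable {q : CollisionKernel} {k Λ : ℝ}

/-- The measure `(1 + |v|²)^(k/2) dv`. -/
noncomputable def weightMeasure (k : ℝ) : Measure Vel :=
  (volume : Measure Vel).withDensity fun v => ENNReal.ofReal (weight k v)

theorem integrable_weightMeasure_iff {g : Vel → ℝ} :
    Integrable g (weightMeasure k) ↔ Integrable fun v => weight k v * g v := by
  rw [weightMeasure, integrable_withDensity_iff_integrable_smul'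
    (measurable_weight k).ennreal_ofReal (.of_forall fun _ => ENNReal.ofReal_lt_top)]
  simp only [ENNReal.toReal_ofReal (weight_pos k _).le, smul_eq_mul]

theorem integral_weightMeasure (g : Vel → ℝ) :
    ∫ v, g v ∂weightMeasure k = ∫ v, weight k v * g v := by
  rw [weightMeasure, integral_withDensity_eq_integral_toReal_smul
    (measurable_weight k).ennreal_ofReal (.of_forall fun _ => ENNReal.ofReal_lt_top)]
  simp only [ENNReal.toReal_ofReal (weight_pos k _).le, smul_eq_mul]

theorem ae_weightMeasure_iff {p : Vel → Prop} :
    (∀ᵐ v ∂weightMeasure k, p v) ↔ ∀ᵐ v, p v := by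
  rw [weightMeasure, ae_withDensity_iff (measurable_weight k).ennreal_ofReal]
  simp [weight_pos]

open Classical in
/-- The class in `L¹_k` of a function; the junk value is `0`. -/
noncomputable def toWeightedL1 (k : ℝ) (g : Vel → ℝ) : WeightedL1 k :=
  if h : Integrable g (weightMeasure k) then h.toL1 g else 0

theorem MemL1.toWeightedL1_eq {g : Vel → ℝ} (hg : MemL1 k g) :
    toWeightedL1 k g = (integrable_weightMeasure_iff.2 hg.integrable).toL1 g :=
  dif_pos _

theorem MemL1.norm_toWeightedL1 {g : Vel → ℝ} (hg : MemL1 k g) :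
    ‖toWeightedL1 k g‖ = wnorm k g := by
  rw [hg.toWeightedL1_eq]
  refine (L1.norm_of_fun_eq_integral_norm _).trans ?_
  exact integral_weightMeasure _

theorem MemL1.toWeightedL1_sub {g h : Vel → ℝ} (hg : MemL1 k g) (hh : MemL1 k h) :
    toWeightedL1 k (fun v => g v - h v) = toWeightedL1 k g - toWeightedL1 k h := by
  rw [hg.toWeightedL1_eq, hh.toWeightedL1_eq, (hg.sub hh).toWeightedL1_eq]
  exact Integrable.toL1_sub _ _ _ _

theorem MemL1.toWeightedL1_const_mul {g : Vel → ℝ} (hg : MemL1 k g) (c : ℝ) :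
    toWeightedL1 k (fun v => c * g v) = c • toWeightedL1 k g := by
  rw [hg.toWeightedL1_eq, (hg.const_mul c).toWeightedL1_eq]
  exact Integrable.toL1_smul g (integrable_weightMeasure_iff.2 hg.integrable) c

theorem MemL1.toWeightedL1_eq_of_ae {g : Vel → ℝ} (hg : MemL1 k g) {F : WeightedL1 k}
    (h : ∀ᵐ v, g v = F v) : toWeightedL1 k g = F := by
  rw [hg.toWeightedL1_eq]
  refine Lp.ext ?_
  exact (Integrable.coeFn_toL1 _).trans (ae_weightMeasure_iff.2 h)

/-- Integration against a test function is a bounded functional on `L¹_k`. -/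
theorem IsTest.exists_functional {C : ℝ} {φ : Vel → ℝ} (hφ : IsTest k C φ) :
    ∃ ℓ : WeightedL1 k →L[ℝ] ℝ, ∀ F : WeightedL1 k,
      Integrable (fun v => φ v * F v) ∧ ℓ F = ∫ v, φ v * F v := by
  have hF (F : WeightedL1 k) : MemL1 k F :=
    ⟨(Lp.stronglyMeasurable F).measurable, integrable_weightMeasure_iff.1 (L1.integrable_coeFn F)⟩
  have hi (F : WeightedL1 k) := (hF F).integrable_mul hφ
  refine ⟨LinearMap.mkContinuous
    { toFun := fun F => ∫ v, φ v * F v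
      map_add' := fun F G => ?_
      map_smul' := fun c F => ?_ } C fun F => ?_, fun F => ⟨hi F, rfl⟩⟩
  · rw [← integral_add (hi F) (hi G)]
    refine integral_congr_ae ?_
    filter_upwards [ae_weightMeasure_iff.1 (Lp.coeFn_add F G)] with v hv
    rw [hv, Pi.add_apply, mul_add]
  · rw [RingHom.id_apply, smul_eq_mul, ← integral_const_mul]
    refine integral_congr_ae ?_
    filter_upwards [ae_weightMeasure_iff.1 (Lp.coeFn_smul c F)] with v hv
    rw [hv, Pi.smul_apply, smul_eq_mul]
    ring
  · refine ((hF F).abs_integral_mul_le hφ).trans_eq ?_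
    rw [← (hF F).norm_toWeightedL1, (hF F).toWeightedL1_eq_of_ae (.of_forall fun _ => rfl)]

/-- A quadratic bound of the first-order remainder yields the derivative. -/
theorem hasDerivWithinAt_of_norm_sub_le_sq {E : Type*} [NormedAddCommGroup E] [NormedSpace ℝ E]
    {F : ℝ → E} {F' : E} {s : Set ℝ} {t L : ℝ}
    (h : ∀ x ∈ s, ‖F x - F t - (x - t) • F'‖ ≤ L * |x - t| ^ 2) : HasDerivWithinAt F F' s t := by
  rw [hasDerivWithinAt_iff_isLittleO]
  have h1 : (fun x => F x - F t - (x - t) • F') =O[nhdsWithin t s] fun x => (x - t) ^ 2 := by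
    refine Asymptotics.IsBigO.of_bound L ?_
    filter_upwards [self_mem_nhdsWithin] with x hx
    simpa [abs_pow] using h x hx
  refine h1.trans_isLittleO ?_
  have h2 : (fun x : ℝ => x - t) =o[nhdsWithin t s] fun _ => (1 : ℝ) := by
    rw [Asymptotics.isLittleO_one_iff]
    have : Filter.Tendsto (fun x : ℝ => x - t) (nhds t) (nhds (t - t)) :=
      (continuous_id.sub continuous_const).tendsto t
    rw [sub_self] at this
    exact this.mono_left nhdsWithin_le_nhds
  simpa [sq] using h2.mul_isBigO (Asymptotics.isBigO_refl (fun x : ℝ => x - t) _)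

section Solution

variable {T : ℝ} {f : ℝ → Vel → ℝ}

theorem IsSolution.memL1 (hf : IsSolution q k T f) {t : ℝ} (ht : t ∈ Icc 0 T) : MemL1 k (f t) :=
  ⟨hf.measurable.comp measurable_prodMk_left, hf.integrable t ht⟩

theorem IsSolution.exists_bound (hf : IsSolution q k T f) :
    ∃ M : ℝ, 0 ≤ M ∧ ∀ t ∈ Icc 0 T, wnorm k (f t) ≤ M := by
  obtain ⟨C, hC⟩ := hf.bounded
  exact ⟨max C 0, le_max_right _ _, fun t ht => (hC t ht).trans (le_max_left _ _)⟩

/-- The equation, which holds pointwise in `v`, is integrated in time and then in `v`. The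
exceptional null sets of velocities where `Q(f, f)` diverges depend on time, but for almost every
`v` only a null set of times is concerned. -/
theorem IsSolution.wnorm_increment_le (hk : 0 ≤ k) (hq : q.RateBound Λ)
    (hf : IsSolution q k T f) {s t K : ℝ} (hs : 0 ≤ s) (hst : s ≤ t) (ht : t ≤ T)
    {G : Vel → ℝ} (hG : MemL1 k G)
    (hK : ∀ τ ∈ Icc s t, wnorm k (fun v => collision q (f τ) (f τ) v - G v) ≤ K) :
    wnorm k (fun v => f t v - f s v - (t - s) * G v) ≤ K * (t - s) := by
  have hsub : Icc s t ⊆ Icc 0 T := Icc_subset_Icc hs ht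
  have hmem (τ : ℝ) (hτ : τ ∈ Icc s t) : MemL1 k fun v => collision q (f τ) (f τ) v - G v :=
    (memL1_collision hk hq (hf.memL1 (hsub hτ)) (hf.memL1 (hsub hτ))).sub hG
  set μ : Measure ℝ := volume.restrict (Ioc s t) with hμ
  set F : ℝ × Vel → ℝ := fun p =>
    weight k p.2 * (collision q (f p.1) (f p.1) p.2 - G p.2) with hF
  have hcoll : Measurable fun p : ℝ × Vel => collision q (f p.1) (f p.1) p.2 :=
    measurable_collision_param q (g := fun p : ℝ × Vel => f p.1) (h := fun p : ℝ × Vel => f p.1)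
      (hf.measurable.comp (by fun_prop : Measurable fun x : (ℝ × Vel) × Vel => (x.1.1, x.2)))
      (hf.measurable.comp (by fun_prop : Measurable fun x : (ℝ × Vel) × Vel => (x.1.1, x.2)))
      measurable_snd
  have hFm : Measurable F := ((measurable_weight k).comp measurable_snd).mul
    (hcoll.sub (hG.measurable.comp measurable_snd))
  have hnorm (τ : ℝ) : ∫ v : Vel, ‖F (τ, v)‖ =
      wnorm k fun v => collision q (f τ) (f τ) v - G v := by
    simp only [hF, wnorm, norm_mul, Real.norm_eq_abs, abs_of_pos (weight_pos k _)]
  have hnm : Measurable fun τ => ∫ v : Vel, ‖F (τ, v)‖ :=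
    hFm.norm.stronglyMeasurable.integral_prod_right'.measurable
  have hmemIoc : ∀ᵐ τ ∂μ, τ ∈ Icc s t := by
    filter_upwards [ae_restrict_mem measurableSet_Ioc] with τ hτ using Ioc_subset_Icc_self hτ
  have hnb : ∀ᵐ τ ∂μ, ‖∫ v : Vel, ‖F (τ, v)‖‖ ≤ K := by
    filter_upwards [hmemIoc] with τ hτ
    rw [Real.norm_of_nonneg (integral_nonneg fun _ => norm_nonneg _), hnorm]
    exact hK τ hτ
  have hint : Integrable F (μ.prod volume) := by
    refine (integrable_prod_iff hFm.aestronglyMeasurable).2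
      ⟨?_, Integrable.of_bound hnm.aestronglyMeasurable K hnb⟩
    filter_upwards [hmemIoc] with τ hτ using (hmem τ hτ).integrable
  have hswap : ∫ v : Vel, ∫ τ, ‖F (τ, v)‖ ∂μ = ∫ τ, (∫ v : Vel, ‖F (τ, v)‖) ∂μ :=
    (integral_integral_swap (f := fun τ (v : Vel) => ‖F (τ, v)‖) hint.norm).symm
  have hbound : ∫ v : Vel, ∫ τ, ‖F (τ, v)‖ ∂μ ≤ K * (t - s) := by
    rw [hswap]
    refine (le_abs_self _).trans ((norm_integral_le_of_norm_le_const hnb).trans_eq ?_)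
    simp [hμ, measureReal_def, ENNReal.toReal_ofReal (sub_nonneg.2 hst)]
  refine le_trans ?_ hbound
  have hd : MemL1 k fun v => f t v - f s v - (t - s) * G v :=
    ((hf.memL1 (hsub ⟨hst, le_rfl⟩)).sub (hf.memL1 (hsub ⟨le_rfl, hst⟩))).sub (hG.const_mul _)
  refine integral_mono_ae hd.integrable_abs hint.norm.integral_prod_right ?_
  -- For almost every `v` the time derivative is integrable, so the fundamental theorem of calculus
  -- applies although `Q(f, f)` may take junk values at some times.
  filter_upwards [hint.prod_left_ae, hf.equation] with v hv heq
  have hv' : IntervalIntegrable (fun τ => collision q (f τ) (f τ) v - G v) volume s t := by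
    rw [intervalIntegrable_iff_integrableOn_Ioc_of_le hst]
    refine (hv.const_mul (weight k v)⁻¹).congr (.of_forall fun τ => ?_)
    simp only [hF]
    rw [inv_mul_cancel_left₀ (weight_pos k v).ne']
  have hc : IntervalIntegrable (fun _ : ℝ => G v) volume s t := intervalIntegrable_const
  have hftc := intervalIntegral.integral_eq_sub_of_hasDeriv_right_of_le (f := fun τ => f τ v)
    (f' := fun τ => collision q (f τ) (f τ) v) hst
    (fun τ hτ => ((heq τ (hsub hτ)).continuousWithinAt).mono hsub)
    (fun τ hτ => ((heq τ (hsub (Ioo_subset_Icc_self hτ))).mono_of_mem_nhdsWithin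
      (Filter.mem_of_superset (Ioo_mem_nhdsGT hτ.2) fun x hx =>
        hsub ⟨hτ.1.le.trans hx.1.le, hx.2.le⟩)))
    ((hv'.add hc).congr (fun τ _ => by simp))
  have hrep : f t v - f s v - (t - s) * G v =
      ∫ τ in s..t, (collision q (f τ) (f τ) v - G v) := by
    have h1 : IntervalIntegrable (fun τ => collision q (f τ) (f τ) v) volume s t :=
      (hv'.add hc).congr (fun τ _ => by simp)
    rw [intervalIntegral.integral_sub h1 hc, hftc]
    simp
  simp only [hrep]
  rw [intervalIntegral.integral_of_le hst, ← abs_of_pos (weight_pos k v), ← abs_mul,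
    ← integral_const_mul]
  refine (norm_integral_le_integral_norm fun τ =>
    weight k v * (collision q (f τ) (f τ) v - G v)).trans_eq ?_
  simp only [hF, hμ]

theorem IsSolution.wnorm_sub_le (hk : 0 ≤ k) (hq : q.RateBound Λ) (hf : IsSolution q k T f)
    {M : ℝ} (hM : ∀ t ∈ Icc 0 T, wnorm k (f t) ≤ M) {s t : ℝ} (hs : s ∈ Icc 0 T)
    (ht : t ∈ Icc 0 T) :
    wnorm k (fun v => f t v - f s v) ≤ 2 * Λ * M ^ 2 * |t - s| := by
  wlog hst : s ≤ t generalizing s t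
  · have := this ht hs (le_of_not_ge hst)
    rw [abs_sub_comm] at this
    simpa only [wnorm, abs_sub_comm] using this
  have h := hf.wnorm_increment_le hk hq hs.1 hst ht.2 (memL1_zero k) (K := 2 * Λ * M ^ 2)
    fun τ hτ => by
      have hτ' : τ ∈ Icc 0 T := ⟨hs.1.trans hτ.1, hτ.2.trans ht.2⟩
      simp only [sub_zero]
      refine (wnorm_collision_le hk hq (hf.memL1 hτ')).trans ?_
      have := hq.1
      have := wnorm_nonneg k (f τ)
      gcongr
      exact hM τ hτ'
  simpa only [mul_zero, sub_zero, abs_of_nonneg (sub_nonneg.2 hst)] using h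

/-- The remainder is quadratic because `t ↦ Q(f(t), f(t))` is Lipschitz in `L¹_k`. -/
theorem IsSolution.wnorm_taylor_le (hk : 0 ≤ k) (hq : q.RateBound Λ) (hf : IsSolution q k T f)
    {M : ℝ} (hM : ∀ t ∈ Icc 0 T, wnorm k (f t) ≤ M) {t x : ℝ} (ht : t ∈ Icc 0 T)
    (hx : x ∈ Icc 0 T) :
    wnorm k (fun v => f x v - f t v - (x - t) * collision q (f t) (f t) v) ≤
      2 * Λ * (4 * M) * (2 * Λ * M ^ 2) * |x - t| ^ 2 := by
  have hΛ := hq.1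
  have hM0 : 0 ≤ M := (wnorm_nonneg k _).trans (hM t ht)
  have hsub (g h : Vel → ℝ) (hg : MemL1 k g) (hh : MemL1 k h) :
      wnorm k (fun v => g v - h v) ≤ wnorm k g + wnorm k h := by
    rw [← hg.norm_toWeightedL1, ← hh.norm_toWeightedL1, ← (hg.sub hh).norm_toWeightedL1,
      hg.toWeightedL1_sub hh]
    exact norm_sub_le _ _
  have hG := memL1_collision hk hq (hf.memL1 ht) (hf.memL1 ht)
  have hK (τ : ℝ) (hτ : τ ∈ Icc 0 T) (hle : |τ - t| ≤ |x - t|) :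
      wnorm k (fun v => collision q (f τ) (f τ) v - collision q (f t) (f t) v) ≤
        2 * Λ * (4 * M) * (2 * Λ * M ^ 2) * |x - t| := by
    refine (wnorm_collision_sub_le hk hq (hf.memL1 hτ) (hf.memL1 ht)).trans ?_
    have h1 := hf.wnorm_sub_le hk hq hM ht hτ
    have h2 := hsub _ _ (hf.memL1 hτ) (hf.memL1 ht)
    have h3 := hM τ hτ
    have h4 := hM t ht
    have h5 : wnorm k (fun v => f τ v - f t v) ≤ 2 * Λ * M ^ 2 * |x - t| :=
      h1.trans (by gcongr)
    rw [mul_assoc (2 * Λ * (4 * M))]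
    have h6 := wnorm_nonneg k (fun v => f τ v - f t v)
    gcongr
    linarith
  rcases le_total t x with h | h
  · have := hf.wnorm_increment_le hk hq ht.1 h hx.2 hG fun τ hτ =>
      hK τ ⟨ht.1.trans hτ.1, hτ.2.trans hx.2⟩ (by
        rw [abs_of_nonneg (sub_nonneg.2 hτ.1), abs_of_nonneg (sub_nonneg.2 h)]; linarith [hτ.2])
    refine this.trans_eq ?_
    rw [abs_of_nonneg (sub_nonneg.2 h)]; ring
  · have := hf.wnorm_increment_le hk hq hx.1 h ht.2 hG fun τ hτ =>
      hK τ ⟨hx.1.trans hτ.1, hτ.2.trans ht.2⟩ (by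
        rw [abs_of_nonpos (sub_nonpos.2 hτ.2), abs_of_nonpos (sub_nonpos.2 h)]; linarith [hτ.1])
    have hsymm : wnorm k (fun v => f x v - f t v - (x - t) * collision q (f t) (f t) v) =
        wnorm k (fun v => f t v - f x v - (t - x) * collision q (f t) (f t) v) := by
      simp only [wnorm]
      refine integral_congr_ae (.of_forall fun v => ?_)
      dsimp only
      rw [← abs_neg]
      congr 2
      ring
    rw [hsymm]
    refine this.trans_eq ?_
    rw [abs_of_nonpos (sub_nonpos.2 h)]; ring

/-- A solution is a differentiable curve in `L¹_k`. -/
theorem IsSolution.hasDerivWithinAt_toWeightedL1 (hk : 0 ≤ k) (hq : q.RateBound Λ)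
    (hf : IsSolution q k T f) {t : ℝ} (ht : t ∈ Icc 0 T) :
    HasDerivWithinAt (fun s => toWeightedL1 k (f s))
      (toWeightedL1 k fun v => collision q (f t) (f t) v) (Icc 0 T) t := by
  obtain ⟨M, _, hM⟩ := hf.exists_bound
  refine hasDerivWithinAt_of_norm_sub_le_sq
    (L := 2 * Λ * (4 * M) * (2 * Λ * M ^ 2)) fun x hx => ?_
  have hG := memL1_collision hk hq (hf.memL1 ht) (hf.memL1 ht)
  have hd := (hf.memL1 hx).sub (hf.memL1 ht)
  rw [← (hf.memL1 hx).toWeightedL1_sub (hf.memL1 ht), ← hG.toWeightedL1_const_mul,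
    ← hd.toWeightedL1_sub (hG.const_mul _), (hd.sub (hG.const_mul _)).norm_toWeightedL1]
  exact hf.wnorm_taylor_le hk hq hM ht hx

/-- Stability of solutions with respect to the initial datum. The barrier `δ exp(K t)` stays below
`1`, and a bound of the difference is only needed where it touches the barrier; hence `K` depends
on a bound `M` of one of the two solutions only. -/
theorem IsSolution.wnorm_sub_le_exp (hk : 0 ≤ k) (hq : q.RateBound Λ) {g : ℝ → Vel → ℝ}
    (hf : IsSolution q k T f) (hg : IsSolution q k T g)
    {M : ℝ} (hM : ∀ t ∈ Icc 0 T, wnorm k (f t) ≤ M) {δ : ℝ} (hδ : 0 < δ)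
    (h0 : wnorm k (fun v => g 0 v - f 0 v) ≤ δ)
    (hsmall : δ * Real.exp ((2 * Λ * (2 * M + 1) + 1) * T) ≤ 1) {t : ℝ} (ht : t ∈ Icc 0 T) :
    wnorm k (fun v => g t v - f t v) ≤ δ * Real.exp ((2 * Λ * (2 * M + 1) + 1) * T) := by
  have hΛ := hq.1
  have hT : 0 ≤ T := ht.1.trans ht.2
  have hM0 : 0 ≤ M := (wnorm_nonneg k _).trans (hM t ht)
  set K := 2 * Λ * (2 * M + 1) + 1 with hKd
  have hK : 0 < K := by positivity
  have hn (s : ℝ) (hs : s ∈ Icc 0 T) : ‖toWeightedL1 k (g s) - toWeightedL1 k (f s)‖ =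
      wnorm k fun v => g s v - f s v := by
    rw [← (hg.memL1 hs).toWeightedL1_sub (hf.memL1 hs),
      ((hg.memL1 hs).sub (hf.memL1 hs)).norm_toWeightedL1]
  have hder (s : ℝ) (hs : s ∈ Icc 0 T) :=
    (hg.hasDerivWithinAt_toWeightedL1 hk hq hs).sub (hf.hasDerivWithinAt_toWeightedL1 hk hq hs)
  have hmono (s : ℝ) (hs : s ∈ Icc 0 T) : δ * Real.exp (K * s) ≤ δ * Real.exp (K * T) := by
    have := hs.2
    gcongr
  have hB (x : ℝ) : HasDerivAt (fun s => δ * Real.exp (K * s)) (δ * (Real.exp (K * x) * K)) x := by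
    have := ((hasDerivAt_id x).const_mul K).exp.const_mul δ
    simpa using this
  have key := image_norm_le_of_norm_deriv_right_lt_deriv_boundary
    (f := fun s => toWeightedL1 k (g s) - toWeightedL1 k (f s))
    (B := fun s => δ * Real.exp (K * s))
    (fun s hs => (hder s hs).continuousWithinAt)
    (fun s hs => (hder s (Ico_subset_Icc_self hs)).mono_of_mem_nhdsWithin
      (Icc_mem_nhdsGE_of_mem hs))
    (by rw [hn 0 ⟨le_rfl, hT⟩]; simpa using h0) hB
    (fun s hs heq => by
      have hs' := Ico_subset_Icc_self hs
      have hQg := memL1_collision hk hq (hg.memL1 hs') (hg.memL1 hs')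
      have hQf := memL1_collision hk hq (hf.memL1 hs') (hf.memL1 hs')
      rw [hn s hs'] at heq
      rw [← hQg.toWeightedL1_sub hQf, (hQg.sub hQf).norm_toWeightedL1]
      refine (wnorm_collision_sub_le hk hq (hg.memL1 hs') (hf.memL1 hs')).trans_lt ?_
      rw [heq]
      have hpos : 0 < δ * Real.exp (K * s) := by positivity
      have hle : δ * Real.exp (K * s) ≤ 1 := (hmono s hs').trans hsmall
      have h1 : 2 * Λ * (2 * wnorm k (f s) + δ * Real.exp (K * s)) < K := by
        have : 2 * Λ * (2 * wnorm k (f s) + δ * Real.exp (K * s)) ≤ 2 * Λ * (2 * M + 1) := by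
          have := hM s hs'
          gcongr
        linarith
      calc _ < K * (δ * Real.exp (K * s)) := mul_lt_mul_of_pos_right h1 hpos
        _ = _ := by ring) ht
  rw [hn t ht] at key
  exact key.trans (hmono t ht)

end Solution

end Boltzmann

/-! ### Existence for the backward problem -/

namespace Boltzmann

section LinearODE

variable {E : Type*} [NormedAddCommGroup E] [NormedSpace ℝ E]

/-- The radial retraction `x ↦ R x / max(R, |x|)` onto the ball of radius `R`. -/
noncomputable def retraction (R : ℝ) (x : E) : E := (R / max R ‖x‖) • x

theorem retraction_of_le {R : ℝ} (hR : 0 < R) {x : E} (hx : ‖x‖ ≤ R) : retraction R x = x := by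
  rw [retraction, max_eq_left hx, div_self hR.ne', one_smul]

theorem norm_retraction_le {R : ℝ} (hR : 0 < R) (x : E) :
    ‖retraction R x‖ ≤ R ∧ ‖retraction R x‖ ≤ ‖x‖ := by
  have hm : 0 < max R ‖x‖ := lt_max_of_lt_left hR
  rw [retraction, norm_smul, Real.norm_of_nonneg (by positivity)]
  constructor
  · rw [div_mul_eq_mul_div, div_le_iff₀ hm]
    exact mul_le_mul_of_nonneg_left (le_max_right _ _) hR.le
  · exact mul_le_of_le_one_left (norm_nonneg _) ((div_le_one hm).2 (le_max_left _ _))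

theorem norm_retraction_sub_le {R : ℝ} (hR : 0 < R) (x y : E) :
    ‖retraction R x - retraction R y‖ ≤ 2 * ‖x - y‖ := by
  have ha : 0 < max R ‖x‖ := lt_max_of_lt_left hR
  have hb : 0 < max R ‖y‖ := lt_max_of_lt_left hR
  have hab : |max R ‖y‖ - max R ‖x‖| ≤ ‖x - y‖ := by
    refine (abs_max_sub_max_le_abs ‖y‖ ‖x‖ R |>.trans' (by rw [max_comm R, max_comm R])).trans ?_
    rw [norm_sub_rev]
    exact abs_norm_sub_norm_le y x
  have hsplit : retraction R x - retraction R y = (R / max R ‖x‖) • (x - y) +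
      ((R / max R ‖x‖) * ((max R ‖y‖ - max R ‖x‖) / max R ‖y‖)) • y := by
    have : (R / max R ‖x‖) * ((max R ‖y‖ - max R ‖x‖) / max R ‖y‖) =
        R / max R ‖x‖ - R / max R ‖y‖ := by field_simp
    rw [this, retraction, retraction]
    module
  have h1 : R / max R ‖x‖ ≤ 1 := (div_le_one ha).2 (le_max_left _ _)
  have h0 : 0 ≤ R / max R ‖x‖ := by positivity
  have h2 : ‖y‖ / max R ‖y‖ ≤ 1 := (div_le_one hb).2 (le_max_right _ _)
  have h20 : 0 ≤ ‖y‖ / max R ‖y‖ := by positivity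
  rw [hsplit]
  refine (norm_add_le _ _).trans ?_
  rw [norm_smul, norm_smul, Real.norm_of_nonneg h0, norm_mul, Real.norm_of_nonneg h0, norm_div,
    Real.norm_of_nonneg hb.le, Real.norm_eq_abs]
  have h3 : R / max R ‖x‖ * ‖x - y‖ ≤ ‖x - y‖ := mul_le_of_le_one_left (norm_nonneg _) h1
  have h4 : R / max R ‖x‖ * (|max R ‖y‖ - max R ‖x‖| / max R ‖y‖) * ‖y‖ ≤ ‖x - y‖ := by
    calc R / max R ‖x‖ * (|max R ‖y‖ - max R ‖x‖| / max R ‖y‖) * ‖y‖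
        = R / max R ‖x‖ * (|max R ‖y‖ - max R ‖x‖| * (‖y‖ / max R ‖y‖)) := by ring
      _ ≤ 1 * (‖x - y‖ * 1) := by gcongr
      _ = ‖x - y‖ := by ring
  linarith

/-- A linear equation with bounded continuous coefficients has global solutions: the
Picard-Lindelöf theorem is applied to the equation truncated by the retraction onto a large ball,
and Grönwall's inequality shows that the solution does not leave that ball. -/
theorem exists_global_solution [CompleteSpace E] {T M : ℝ} (hT : 0 ≤ T) (hM : 0 ≤ M)
    {A : ℝ → E → E} (h0 : ∀ t ∈ Icc 0 T, A t 0 = 0)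
    (hlip : ∀ t ∈ Icc 0 T, ∀ x y, ‖A t x - A t y‖ ≤ M * ‖x - y‖)
    (hcont : ∀ x, ContinuousOn (fun t => A t x) (Icc 0 T)) (x₀ : E) :
    ∃ x : ℝ → E, x 0 = x₀ ∧
      ∀ t ∈ Icc 0 T, HasDerivWithinAt x (A t (x t)) (Icc 0 T) t := by
  -- The bound of Grönwall's inequality, enlarged so that the radius is positive for `x₀ = 0`.
  set R : ℝ := (‖x₀‖ + 1) * Real.exp (M * T) with hRd
  have hR : 0 < R := by positivity
  have hbd (t : ℝ) (ht : t ∈ Icc 0 T) (x : E) : ‖A t x‖ ≤ M * ‖x‖ := by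
    simpa [h0 t ht] using hlip t ht x 0
  have hPL : IsPicardLindelof (fun t x => A t (retraction R x))
      (⟨0, le_rfl, hT⟩ : Icc 0 T) x₀ (NNReal.mk (M * R * T) (by positivity)) 0
      (NNReal.mk (M * R) (by positivity)) (NNReal.mk (M * 2) (by positivity)) := by
    refine ⟨fun t ht => LipschitzOnWith.of_dist_le_mul fun x _ y _ => ?_,
      fun x _ => hcont _, fun t ht x _ => ?_, ?_⟩
    · rw [dist_eq_norm, dist_eq_norm]
      refine (hlip t ht _ _).trans ?_
      rw [NNReal.coe_mk, mul_assoc]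
      exact mul_le_mul_of_nonneg_left (norm_retraction_sub_le hR x y) hM
    · exact (hbd t ht _).trans (mul_le_mul_of_nonneg_left (norm_retraction_le hR x).1 hM)
    · simp [hT]
  obtain ⟨x, hx0, hx⟩ := hPL.exists_eq_forall_mem_Icc_hasDerivWithinAt₀
  refine ⟨x, hx0, fun t ht => ?_⟩
  have hgr := norm_le_gronwallBound_of_norm_deriv_right_le (f := x) (δ := ‖x₀‖) (K := M) (ε := 0)
    (fun s hs => (hx s hs).continuousWithinAt)
    (fun s hs => (hx s (Ico_subset_Icc_self hs)).mono_of_mem_nhdsWithin (Icc_mem_nhdsGE_of_mem hs))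
    (by rw [← hx0])
    (fun s hs => by
      rw [add_zero]
      exact (hbd s (Ico_subset_Icc_self hs) _).trans
        (mul_le_mul_of_nonneg_left (norm_retraction_le hR _).2 hM)) t ht
  have hle : ‖x t‖ ≤ R := by
    refine hgr.trans ?_
    rw [gronwallBound_ε0, sub_zero, hRd]
    have := ht.2
    gcongr
    linarith
  have := hx t ht
  rwa [retraction_of_le hR hle] at this

end LinearODE

variable {q : CollisionKernel} {k Λ C : ℝ} {f g φ η : Vel → ℝ}

/-- The integrand of `L*[f] φ` at the velocity `v`. -/
noncomputable def adjointIntegrand (q : CollisionKernel) (f φ : Vel → ℝ) (v : Vel)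
    (y : Vel × Sph) : ℝ :=
  f y.1 * (φ (post v y.1 y.2) + φ (post₁ v y.1 y.2) - φ v - φ y.1) * q.eval (v - y.1) y.2

theorem integrable_adjointIntegrand (hk : 0 ≤ k) (hq : q.RateBound Λ) (hf : MemL1 k f)
    (hφ : IsTest k C φ) (v : Vel) :
    Integrable (adjointIntegrand q f φ v) (volume.prod surf) ∧
    |∫ y, adjointIntegrand q f φ v y ∂((volume : Measure Vel).prod surf)| ≤
      4 * C * Λ * wnorm k f * weight k v := by
  obtain ⟨h1, h2⟩ := integrable_rate_section hq v hf.integrable_abs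
    fun v => mul_nonneg (weight_pos k v).le (abs_nonneg _)
  have hC := hφ.nonneg
  have hle (y : Vel × Sph) : ‖adjointIntegrand q f φ v y‖ ≤
      4 * C * weight k v * (weight k y.1 * |f y.1| * q.eval (v - y.1) y.2) := by
    have hs : |φ (post v y.1 y.2) + φ (post₁ v y.1 y.2) - φ v - φ y.1| ≤
        4 * (C * (weight k v * weight k y.1)) := by
      have a1 := abs_le.1 (hφ.abs_post_le hk v y.1 y.2)
      have a2 := abs_le.1 (hφ.abs_post₁_le hk v y.1 y.2)
      have a3 := abs_le.1 (hφ.abs_left_le hk v y.1)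
      have a4 := abs_le.1 (hφ.abs_right_le hk v y.1)
      exact abs_le.2 ⟨by linarith [a1.1, a2.1, a3.2, a4.2], by linarith [a1.2, a2.2, a3.1, a4.1]⟩
    have hqn := q.eval_nonneg (v - y.1) y.2
    rw [adjointIntegrand, Real.norm_eq_abs, abs_mul, abs_mul, abs_of_nonneg hqn]
    calc |f y.1| * _ * q.eval (v - y.1) y.2
        ≤ |f y.1| * (4 * (C * (weight k v * weight k y.1))) * q.eval (v - y.1) y.2 := by gcongr
      _ = _ := by ring
  have hy : Measurable fun y : Vel × Sph => (v, y.1, y.2) := by fun_prop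
  have hmq : Measurable fun y : Vel × Sph => q.eval (v - y.1) y.2 :=
    q.measurable_eval.comp (f := fun y : Vel × Sph => (v - y.1, y.2)) (by fun_prop)
  have hmeas : Measurable (adjointIntegrand q f φ v) :=
    ((hf.measurable.comp measurable_fst).mul ((((hφ.measurable_post.comp hy).add
      (hφ.measurable_post₁.comp hy)).sub_const _).sub (hφ.measurable.comp measurable_fst))).mul hmq
  have hdom := h1.const_mul (4 * C * weight k v)
  refine ⟨hdom.mono' hmeas.aestronglyMeasurable (.of_forall hle), ?_⟩
  refine (norm_integral_le_of_norm_le hdom (.of_forall hle)).trans ?_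
  rw [integral_const_mul]
  have hw := (weight_pos k v).le
  refine (mul_le_mul_of_nonneg_left h2 (by positivity)).trans_eq ?_
  simp only [wnorm]
  ring

theorem linearizedAdjoint_eq (hk : 0 ≤ k) (hq : q.RateBound Λ) (hf : MemL1 k f)
    (hφ : IsTest k C φ) (v : Vel) :
    linearizedAdjoint q f φ v =
      ∫ y, adjointIntegrand q f φ v y ∂((volume : Measure Vel).prod surf) :=
  (integral_prod _ (integrable_adjointIntegrand hk hq hf hφ v).1).symm

theorem abs_linearizedAdjoint_le (hk : 0 ≤ k) (hq : q.RateBound Λ) (hf : MemL1 k f)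
    (hφ : IsTest k C φ) (v : Vel) :
    |linearizedAdjoint q f φ v| ≤ 4 * C * Λ * wnorm k f * weight k v := by
  rw [linearizedAdjoint_eq hk hq hf hφ]
  exact (integrable_adjointIntegrand hk hq hf hφ v).2

theorem IsTest.sub {C' : ℝ} (hφ : IsTest k C φ) (hη : IsTest k C' η) :
    IsTest k (C + C') fun v => φ v - η v :=
  ⟨hφ.measurable.sub hη.measurable, fun v => by
    refine (abs_sub _ _).trans ?_
    linarith [hφ.bound v, hη.bound v]⟩

theorem linearizedAdjoint_sub_right {C' : ℝ} (hk : 0 ≤ k) (hq : q.RateBound Λ) (hf : MemL1 k f)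
    (hφ : IsTest k C φ) (hη : IsTest k C' η) (v : Vel) :
    linearizedAdjoint q f (fun v => φ v - η v) v =
      linearizedAdjoint q f φ v - linearizedAdjoint q f η v := by
  rw [linearizedAdjoint_eq hk hq hf hφ, linearizedAdjoint_eq hk hq hf hη,
    linearizedAdjoint_eq hk hq hf (hφ.sub hη),
    ← integral_sub (integrable_adjointIntegrand hk hq hf hφ v).1
      (integrable_adjointIntegrand hk hq hf hη v).1]
  refine integral_congr_ae (.of_forall fun y => ?_)
  simp only [adjointIntegrand]
  ring

theorem linearizedAdjoint_sub_left (hk : 0 ≤ k) (hq : q.RateBound Λ) (hf : MemL1 k f)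
    (hg : MemL1 k g) (hφ : IsTest k C φ) (v : Vel) :
    linearizedAdjoint q (fun v => f v - g v) φ v =
      linearizedAdjoint q f φ v - linearizedAdjoint q g φ v := by
  rw [linearizedAdjoint_eq hk hq hf hφ, linearizedAdjoint_eq hk hq hg hφ,
    linearizedAdjoint_eq hk hq (hf.sub hg) hφ,
    ← integral_sub (integrable_adjointIntegrand hk hq hf hφ v).1
      (integrable_adjointIntegrand hk hq hg hφ v).1]
  refine integral_congr_ae (.of_forall fun y => ?_)
  simp only [adjointIntegrand]
  ring

theorem measurable_linearizedAdjoint (q : CollisionKernel) (hf : Measurable f)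
    (hφ : Measurable φ) : Measurable fun v => linearizedAdjoint q f φ v := by
  have hx : Measurable fun x : (Vel × Vel) × Sph => (x.1.1, x.1.2, x.2) := by fun_prop
  have h1 : Measurable fun x : (Vel × Vel) × Sph => x.1.1 := by fun_prop
  have h2 : Measurable fun x : (Vel × Vel) × Sph => x.1.2 := by fun_prop
  have h := ((hf.comp h2).mul ((((hφ.comp (measurable_post.comp hx)).add
    (hφ.comp (measurable_post₁.comp hx))).sub (hφ.comp h1)).sub (hφ.comp h2))).mul
    ((measurable_eval_sub q).comp hx)
  exact (h.stronglyMeasurable.integral_prod_right (ν := surf)).integral_prod_right.measurable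

/-- The Banach space of bounded measurable functions of the velocity, defined everywhere, with the
supremum norm. -/
noncomputable def boundedMeasurable : Submodule ℝ (lp (fun _ : Vel => ℝ) ⊤) where
  carrier := {x | Measurable fun v => x v}
  add_mem' hx hy := Measurable.add hx hy
  zero_mem' := measurable_const
  smul_mem' c _ hx := Measurable.const_mul hx c

theorem isClosed_boundedMeasurable :
    IsClosed (boundedMeasurable : Set (lp (fun _ : Vel => ℝ) ⊤)) := by
  refine IsSeqClosed.isClosed fun x y hx hxy => ?_
  refine measurable_of_tendsto_metrizable (f := fun n v => x n v) (fun n => hx n) ?_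
  refine tendsto_pi_nhds.2 fun v => ?_
  exact ((lp.evalCLM ℝ (fun _ : Vel => ℝ) ⊤ v).continuous.tendsto y).comp hxy

instance : CompleteSpace boundedMeasurable :=
  isClosed_boundedMeasurable.completeSpace_coe

/-- Evaluation of a bounded measurable function at a velocity. -/
noncomputable def evalAt (v : Vel) : boundedMeasurable →L[ℝ] ℝ :=
  (lp.evalCLM ℝ (fun _ : Vel => ℝ) ⊤ v).comp boundedMeasurable.subtypeL

theorem abs_evalAt_le (v : Vel) (x : boundedMeasurable) : |evalAt v x| ≤ ‖x‖ :=
  lp.norm_apply_le_norm ENNReal.top_ne_zero (x : lp (fun _ : Vel => ℝ) ⊤) v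

theorem norm_le_of_abs_evalAt_le {x : boundedMeasurable} {B : ℝ} (hB : 0 ≤ B)
    (h : ∀ v, |evalAt v x| ≤ B) : ‖x‖ ≤ B :=
  lp.norm_le_of_forall_le (f := (x : lp (fun _ : Vel => ℝ) ⊤)) hB h

theorem measurable_evalAt (x : boundedMeasurable) : Measurable fun v => evalAt v x := x.2

open Classical in
/-- A bounded measurable function as an element of the Banach space; the junk value is `0`. -/
noncomputable def toBounded (φ : Vel → ℝ) : boundedMeasurable :=
  if h : Measurable φ ∧ ∃ B, ∀ v, |φ v| ≤ B then
    ⟨⟨φ, memℓp_infty ⟨h.2.choose, by rintro _ ⟨v, rfl⟩; exact h.2.choose_spec v⟩⟩, h.1⟩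
  else 0

theorem evalAt_toBounded (hφ : Measurable φ) {B : ℝ} (hB : ∀ v, |φ v| ≤ B) (v : Vel) :
    evalAt v (toBounded φ) = φ v := by
  rw [toBounded, dif_pos ⟨hφ, B, hB⟩]
  rfl

theorem isTest_weight_mul (k : ℝ) (x : boundedMeasurable) :
    IsTest k ‖x‖ fun v => weight k v * evalAt v x :=
  ⟨(measurable_weight k).mul (measurable_evalAt x), fun v => by
    rw [abs_mul, abs_of_pos (weight_pos k v), mul_comm]
    exact mul_le_mul_of_nonneg_right (abs_evalAt_le v x) (weight_pos k v).le⟩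

/-- The operator `L*[f]` conjugated by the weight, on the space of bounded measurable functions. -/
noncomputable def adjointOperator (q : CollisionKernel) (k : ℝ) (f : Vel → ℝ)
    (x : boundedMeasurable) : boundedMeasurable :=
  toBounded fun v => (weight k v)⁻¹ * linearizedAdjoint q f (fun v => weight k v * evalAt v x) v

theorem weight_inv_mul_le {a B v} (h : |a| ≤ B * weight k v) : |(weight k v)⁻¹ * a| ≤ B := by
  rw [abs_mul, abs_of_pos (inv_pos.2 (weight_pos k v)), inv_mul_le_iff₀ (weight_pos k v), mul_comm]
  exact h

theorem evalAt_adjointOperator (hk : 0 ≤ k) (hq : q.RateBound Λ) (hf : MemL1 k f)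
    (x : boundedMeasurable) (v : Vel) :
    evalAt v (adjointOperator q k f x) =
      (weight k v)⁻¹ * linearizedAdjoint q f (fun v => weight k v * evalAt v x) v :=
  evalAt_toBounded ((measurable_weight k).inv.mul
    (measurable_linearizedAdjoint q hf.measurable (isTest_weight_mul k x).measurable))
    (fun v => weight_inv_mul_le (abs_linearizedAdjoint_le hk hq hf (isTest_weight_mul k x) v)) v

theorem norm_adjointOperator_sub_right_le (hk : 0 ≤ k) (hq : q.RateBound Λ) (hf : MemL1 k f)
    (x y : boundedMeasurable) :
    ‖adjointOperator q k f x - adjointOperator q k f y‖ ≤ 4 * Λ * wnorm k f * ‖x - y‖ := by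
  have hΛ := hq.1
  have hn := wnorm_nonneg k f
  refine norm_le_of_abs_evalAt_le (by positivity) fun v => ?_
  rw [map_sub, evalAt_adjointOperator hk hq hf, evalAt_adjointOperator hk hq hf, ← mul_sub,
    ← linearizedAdjoint_sub_right hk hq hf (isTest_weight_mul k x) (isTest_weight_mul k y)]
  refine weight_inv_mul_le ?_
  have h := abs_linearizedAdjoint_le hk hq hf (isTest_weight_mul k (x - y)) v
  simp only [map_sub, mul_sub] at h
  refine h.trans_eq ?_
  ring

theorem norm_adjointOperator_sub_left_le (hk : 0 ≤ k) (hq : q.RateBound Λ) (hf : MemL1 k f)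
    (hg : MemL1 k g) (x : boundedMeasurable) :
    ‖adjointOperator q k f x - adjointOperator q k g x‖ ≤
      4 * ‖x‖ * Λ * wnorm k fun v => f v - g v := by
  have hΛ := hq.1
  have hn := wnorm_nonneg k fun v => f v - g v
  refine norm_le_of_abs_evalAt_le (by positivity) fun v => ?_
  rw [map_sub, evalAt_adjointOperator hk hq hf, evalAt_adjointOperator hk hq hg, ← mul_sub,
    ← linearizedAdjoint_sub_left hk hq hf hg (isTest_weight_mul k x)]
  exact weight_inv_mul_le (abs_linearizedAdjoint_le hk hq (hf.sub hg) (isTest_weight_mul k x) v)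

theorem adjointOperator_zero (q : CollisionKernel) (k : ℝ) (f : Vel → ℝ) :
    adjointOperator q k f 0 = 0 := by
  have h (v : Vel) : linearizedAdjoint q f (fun _ => 0) v = 0 := by simp [linearizedAdjoint]
  refine norm_le_zero_iff.1 (norm_le_of_abs_evalAt_le le_rfl fun v => ?_)
  simp only [adjointOperator, map_zero, mul_zero, h]
  rw [evalAt_toBounded measurable_const (B := 0) (by simp)]
  simp

/-- The backward problem is solved as a linear equation with time reversed in the space of bounded
measurable functions, so that the equation holds for every velocity. -/
theorem IsSolution.exists_isAdjointSolution {T : ℝ} (hT : 0 ≤ T) (hk : 0 ≤ k)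
    (hq : q.RateBound Λ) {f : ℝ → Vel → ℝ} (hf : IsSolution q k T f) {r : Vel → ℝ}
    (hr : IsTest k C r) : ∃ γ, IsAdjointSolution q k T f r γ := by
  obtain ⟨M, hM0, hM⟩ := hf.exists_bound
  have hΛ := hq.1
  have hrev {s : ℝ} (hs : s ∈ Icc 0 T) : T - s ∈ Icc 0 T := ⟨by linarith [hs.2], by linarith [hs.1]⟩
  obtain ⟨x, hx0, hx⟩ := exists_global_solution (A := fun s => adjointOperator q k (f (T - s)))
    (M := 4 * Λ * M) hT (by positivity) (fun s _ => adjointOperator_zero _ _ _)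
    (fun s hs x y => (norm_adjointOperator_sub_right_le hk hq (hf.memL1 (hrev hs)) x y).trans (by
      have := hM _ (hrev hs)
      gcongr))
    (fun x => by
      refine (LipschitzOnWith.of_dist_le_mul (K := NNReal.mk
        (4 * ‖x‖ * Λ * (2 * Λ * M ^ 2)) (by positivity)) fun s hs t ht => ?_).continuousOn
      rw [dist_eq_norm]
      refine (norm_adjointOperator_sub_left_le hk hq (hf.memL1 (hrev hs)) (hf.memL1 (hrev ht))
        x).trans ?_
      have h := hf.wnorm_sub_le hk hq hM (hrev ht) (hrev hs)
      rw [NNReal.coe_mk, Real.dist_eq, mul_assoc _ (2 * Λ * M ^ 2)]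
      refine mul_le_mul_of_nonneg_left (h.trans_eq ?_) (by positivity)
      rw [abs_sub_comm s t]
      congr 2
      ring)
    (toBounded fun v => -((weight k v)⁻¹ * r v))
  -- Joint measurability is required on all of `ℝ × ℝ³`: times outside `[0, T]` are clamped.
  set c : ℝ → ℝ := fun t => max 0 (min T t) with hc
  have hcmem (t : ℝ) : c t ∈ Icc 0 T := ⟨le_max_left _ _, max_le hT (min_le_left _ _)⟩
  have hcid {t : ℝ} (ht : t ∈ Icc 0 T) : c t = t := by
    simp only [hc, min_eq_right ht.2, max_eq_right ht.1]
  have hxc : ContinuousOn x (Icc 0 T) := fun s hs => (hx s hs).continuousWithinAt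
  have hcont : Continuous fun t => x (T - c t) :=
    hxc.comp_continuous (by fun_prop) fun t => hrev (hcmem t)
  obtain ⟨B, hB⟩ := isCompact_Icc.exists_bound_of_continuousOn hxc
  refine ⟨fun t v => weight k v * evalAt v (x (T - c t)), ?_, ⟨B, fun t _ v => ?_⟩, ?_, ?_⟩
  · exact measurable_uncurry_of_continuous_of_measurable
      (fun v => continuous_const.mul ((evalAt v).continuous.comp hcont))
      (fun t => (isTest_weight_mul k _).measurable)
  · exact ((isTest_weight_mul k _).bound v).trans
      (mul_le_mul_of_nonneg_right (hB _ (hrev (hcmem t))) (weight_pos k v).le)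
  · intro v t ht
    have h1 : HasDerivWithinAt (fun s => x (T - s))
        (-adjointOperator q k (f t) (x (T - t))) (Icc 0 T) t := by
      have h2 := (hx (T - t) (hrev ht)).scomp t
        ((hasDerivWithinAt_id t (Icc 0 T)).const_sub T) fun s hs => hrev hs
      simpa [Function.comp_def] using h2
    have h3 := (((evalAt v).hasFDerivAt.comp_hasDerivWithinAt t h1).const_mul (weight k v)).congr
      (f₁ := fun s => weight k v * evalAt v (x (T - c s)))
      (fun s hs => by simp [hcid hs]) (by simp [hcid ht])
    rw [map_neg, evalAt_adjointOperator hk hq (hf.memL1 ht), mul_neg,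
      mul_inv_cancel_left₀ (weight_pos k v).ne'] at h3
    simpa only [hcid ht] using h3
  · intro v
    have he := evalAt_toBounded (φ := fun v => -((weight k v)⁻¹ * r v))
      ((measurable_weight k).inv.mul hr.measurable).neg
      (fun v => by rw [abs_neg]; exact weight_inv_mul_le (hr.bound v)) v
    rw [hcid ⟨hT, le_rfl⟩, sub_self, hx0, he, mul_neg, mul_inv_cancel_left₀ (weight_pos k v).ne']

end Boltzmann

/-! ### The gradient formula -/

namespace Boltzmann

variable {q : CollisionKernel} {k Λ T : ℝ} {f g γ : ℝ → Vel → ℝ} {r : Vel → ℝ}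

theorem IsAdjointSolution.exists_isTest (hγ : IsAdjointSolution q k T f r γ) :
    ∃ C : ℝ, ∀ t ∈ Icc 0 T, IsTest k C (γ t) := by
  obtain ⟨C, hC⟩ := hγ.bounded
  exact ⟨C, fun t ht => ⟨hγ.measurable.comp measurable_prodMk_left, hC t ht⟩⟩

/-- The adjoint solution is Lipschitz in time, uniformly in `v` relative to the weight. -/
theorem IsAdjointSolution.isTest_sub (hk : 0 ≤ k) (hq : q.RateBound Λ)
    (hf : IsSolution q k T f) (hγ : IsAdjointSolution q k T f r γ) {C M : ℝ}
    (hC : ∀ t ∈ Icc 0 T, IsTest k C (γ t)) (hM : ∀ t ∈ Icc 0 T, wnorm k (f t) ≤ M)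
    {x t : ℝ} (hx : x ∈ Icc 0 T) (ht : t ∈ Icc 0 T) :
    IsTest k (4 * C * Λ * M * |x - t|) fun v => γ x v - γ t v := by
  refine ⟨(hC x hx).measurable.sub (hC t ht).measurable, fun v => ?_⟩
  have h := Convex.norm_image_sub_le_of_norm_hasDerivWithin_le (f := fun s => γ s v)
    (C := 4 * C * Λ * M * weight k v) (hγ.equation v) (fun s hs => by
      rw [norm_neg]
      refine (abs_linearizedAdjoint_le hk hq (hf.memL1 hs) (hC s hs) v).trans ?_
      have := hq.1
      have := (hC s hs).nonneg
      have := (weight_pos k v).le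
      have := hM s hs
      gcongr) (convex_Icc 0 T) ht hx
  rw [Real.norm_eq_abs, Real.norm_eq_abs] at h
  linarith

theorem MemL1.integral_mul_toWeightedL1 {u : Vel → ℝ} (hu : MemL1 k u) (φ : Vel → ℝ) :
    ∫ v, φ v * toWeightedL1 k u v = ∫ v, φ v * u v := by
  refine integral_congr_ae ?_
  rw [hu.toWeightedL1_eq]
  filter_upwards [ae_weightMeasure_iff.1
    (Integrable.coeFn_toL1 (integrable_weightMeasure_iff.2 hu.integrable))] with v hv
  exact congrArg (φ v * ·) hv

/-- The pairing of the adjoint solution with the difference of two solutions is differentiable in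
time, by the product rule. The adjoint solution is differentiable only pointwise in `v`, with
locally bounded difference quotients; its contribution comes from dominated convergence. -/
theorem IsAdjointSolution.hasDerivWithinAt_pairing (hk : 0 ≤ k) (hq : q.RateBound Λ)
    (hf : IsSolution q k T f) (hg : IsSolution q k T g) (hγ : IsAdjointSolution q k T f r γ)
    {t : ℝ} (ht : t ∈ Icc 0 T) :
    HasDerivWithinAt (fun s => ∫ v, γ s v * (g s v - f s v))
      ((∫ v, γ t v * (collision q (g t) (g t) v - collision q (f t) (f t) v)) -
        ∫ v, (g t v - f t v) * linearizedAdjoint q (f t) (γ t) v) (Icc 0 T) t := by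
  obtain ⟨C, hC⟩ := hγ.exists_isTest
  obtain ⟨M, hM0, hM⟩ := hf.exists_bound
  obtain ⟨N, hN0, hN⟩ := hg.exists_bound
  have hd (s : ℝ) (hs : s ∈ Icc 0 T) : MemL1 k fun v => g s v - f s v :=
    (hg.memL1 hs).sub (hf.memL1 hs)
  have hLip (x : ℝ) (hx : x ∈ Icc 0 T) := hγ.isTest_sub hk hq hf hC hM hx ht
  have hC0 : 0 ≤ C := (hC t ht).nonneg
  have hΛ := hq.1
  -- The pairing at time `s` is split into a part with `γ` frozen at `t`, a part with the difference
  -- of the solutions frozen at `t`, and a product of two increments, which is quadratic in `s - t`.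
  have ha : HasDerivWithinAt (fun s => ∫ v, γ t v * (g s v - f s v))
      (∫ v, γ t v * (collision q (g t) (g t) v - collision q (f t) (f t) v)) (Icc 0 T) t := by
    obtain ⟨ℓ, hℓ⟩ := (hC t ht).exists_functional
    have hQg := memL1_collision hk hq (hg.memL1 ht) (hg.memL1 ht)
    have hQf := memL1_collision hk hq (hf.memL1 ht) (hf.memL1 ht)
    have h1 := ℓ.hasFDerivAt.comp_hasDerivWithinAt t
      ((hg.hasDerivWithinAt_toWeightedL1 hk hq ht).sub (hf.hasDerivWithinAt_toWeightedL1 hk hq ht))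
    have hval (s : ℝ) (hs : s ∈ Icc 0 T) : ℓ (toWeightedL1 k (g s) - toWeightedL1 k (f s)) =
        ∫ v, γ t v * (g s v - f s v) := by
      rw [← (hg.memL1 hs).toWeightedL1_sub (hf.memL1 hs), (hℓ _).2,
        (hd s hs).integral_mul_toWeightedL1]
    rw [← hQg.toWeightedL1_sub hQf, (hℓ _).2, (hQg.sub hQf).integral_mul_toWeightedL1] at h1
    exact h1.congr (fun s hs => (hval s hs).symm) (hval t ht).symm
  have hb : HasDerivWithinAt (fun s => ∫ v, (γ s v - γ t v) * (g t v - f t v))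
      (∫ v, -linearizedAdjoint q (f t) (γ t) v * (g t v - f t v)) (Icc 0 T) t := by
    rw [hasDerivWithinAt_iff_tendsto_slope]
    have hsl : slope (fun s => ∫ v, (γ s v - γ t v) * (g t v - f t v)) t =
        fun s => ∫ v, slope (fun s => γ s v) t s * (g t v - f t v) := by
      funext s
      simp only [slope_def_field, sub_self, zero_mul, integral_zero, sub_zero]
      rw [div_eq_inv_mul, ← integral_const_mul]
      refine integral_congr_ae (.of_forall fun v => ?_)
      ring
    rw [hsl]
    refine tendsto_integral_filter_of_dominated_convergence
      (fun v => 4 * C * Λ * M * (weight k v * |g t v - f t v|)) ?_ ?_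
      ((hd t ht).integrable_abs.const_mul _) (.of_forall fun v => ?_)
    · filter_upwards [self_mem_nhdsWithin] with s hs
      simp only [slope_def_field]
      exact (((hLip s hs.1).measurable.div_const _).mul (hd t ht).measurable).aestronglyMeasurable
    · filter_upwards [self_mem_nhdsWithin] with s hs
      refine .of_forall fun v => ?_
      have hst : 0 < |s - t| := abs_pos.2 (sub_ne_zero.2 hs.2)
      rw [slope_def_field, Real.norm_eq_abs, abs_mul, abs_div, ← mul_assoc]
      refine mul_le_mul_of_nonneg_right ?_ (abs_nonneg _)
      rw [div_le_iff₀ hst]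
      refine ((hLip s hs.1).bound v).trans_eq ?_
      ring
    · exact (hasDerivWithinAt_iff_tendsto_slope.1 (hγ.equation v t ht)).mul_const _
  have he : HasDerivWithinAt
      (fun s => ∫ v, (γ s v - γ t v) * ((g s v - f s v) - (g t v - f t v))) 0 (Icc 0 T) t := by
    refine hasDerivWithinAt_of_norm_sub_le_sq
      (L := 4 * C * Λ * M * (2 * Λ * N ^ 2 + 2 * Λ * M ^ 2)) fun s hs => ?_
    have hdd := (hd s hs).sub (hd t ht)
    have h1 := hdd.abs_integral_mul_le (hLip s hs)
    have h2 : wnorm k (fun v => (g s v - f s v) - (g t v - f t v)) ≤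
        (2 * Λ * N ^ 2 + 2 * Λ * M ^ 2) * |s - t| := by
      have e1 := (hg.memL1 hs).sub (hg.memL1 ht)
      have e2 := (hf.memL1 hs).sub (hf.memL1 ht)
      have h3 : wnorm k (fun v => (g s v - f s v) - (g t v - f t v)) =
          ‖toWeightedL1 k (fun v => g s v - g t v) - toWeightedL1 k (fun v => f s v - f t v)‖ := by
        rw [← e1.toWeightedL1_sub e2, (e1.sub e2).norm_toWeightedL1]
        congr 1
        funext v
        ring
      rw [h3]
      refine (norm_sub_le _ _).trans ?_
      rw [e1.norm_toWeightedL1, e2.norm_toWeightedL1]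
      linarith [hg.wnorm_sub_le hk hq hN ht hs, hf.wnorm_sub_le hk hq hM ht hs]
    simp only [sub_self, zero_mul, integral_zero, sub_zero, smul_zero, Real.norm_eq_abs]
    refine h1.trans ?_
    calc 4 * C * Λ * M * |s - t| * wnorm k (fun v => (g s v - f s v) - (g t v - f t v))
        ≤ 4 * C * Λ * M * |s - t| * ((2 * Λ * N ^ 2 + 2 * Λ * M ^ 2) * |s - t|) := by gcongr
      _ = _ := by ring
  have hsum (s : ℝ) (hs : s ∈ Icc 0 T) : ∫ v, γ s v * (g s v - f s v) =
      (∫ v, γ t v * (g s v - f s v)) + (∫ v, (γ s v - γ t v) * (g t v - f t v)) +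
        ∫ v, (γ s v - γ t v) * ((g s v - f s v) - (g t v - f t v)) := by
    have i1 := (hd s hs).integrable_mul (hC t ht)
    have i2 := (hd t ht).integrable_mul (hLip s hs)
    have i3 := ((hd s hs).sub (hd t ht)).integrable_mul (hLip s hs)
    rw [← integral_add i1 i2]
    refine Eq.trans ?_ (integral_add (i1.add i2) i3)
    refine integral_congr_ae (.of_forall fun v => ?_)
    dsimp only
    ring
  refine (((ha.add hb).add he).congr hsum (hsum t ht)).congr_deriv ?_
  rw [add_zero, sub_eq_add_neg, ← integral_neg]
  congr 1
  refine integral_congr_ae (.of_forall fun v => ?_)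
  ring

/-- The change of the objective equals minus the pairing of `γ(0)` with the change of the initial
datum, up to a quadratic error. -/
theorem IsAdjointSolution.abs_objective_sub_le (hT : 0 ≤ T) (hk : 0 ≤ k) (hq : q.RateBound Λ)
    (hf : IsSolution q k T f) (hg : IsSolution q k T g) (hγ : IsAdjointSolution q k T f r γ)
    {C M D : ℝ} (hC : ∀ t ∈ Icc 0 T, IsTest k C (γ t)) (hr : IsTest k M r)
    (hD : ∀ t ∈ Icc 0 T, wnorm k (fun v => g t v - f t v) ≤ D) :
    |(∫ v, r v * g T v) - (∫ v, r v * f T v) + ∫ v, γ 0 v * (g 0 v - f 0 v)| ≤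
      2 * C * Λ * D ^ 2 * T := by
  have hT' : T ∈ Icc 0 T := ⟨hT, le_rfl⟩
  have h0 : (0 : ℝ) ∈ Icc 0 T := ⟨le_rfl, hT⟩
  have h := Convex.norm_image_sub_le_of_norm_hasDerivWithin_le (C := 2 * C * Λ * D ^ 2)
    (fun t ht => hγ.hasDerivWithinAt_pairing hk hq hf hg ht)
    (fun t ht => by
      refine (abs_collision_sub_linearization_le hk hq (hg.memL1 ht) (hf.memL1 ht)
        (hC t ht)).trans ?_
      have := hq.1
      have := (hC t ht).nonneg
      have := wnorm_nonneg k fun v => g t v - f t v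
      have := hD t ht
      gcongr) (convex_Icc 0 T) h0 hT'
  have hend : ∫ v, γ T v * (g T v - f T v) = -((∫ v, r v * g T v) - ∫ v, r v * f T v) := by
    rw [← integral_sub ((hg.memL1 hT').integrable_mul hr) ((hf.memL1 hT').integrable_mul hr),
      ← integral_neg]
    refine integral_congr_ae (.of_forall fun v => ?_)
    simp only [hγ.final]
    ring
  rw [hend, sub_zero, Real.norm_eq_abs, Real.norm_eq_abs, abs_of_nonneg hT] at h
  rw [← abs_neg]
  refine Eq.trans_le ?_ h
  congr 1
  ring

open Asymptotics Filter Topology in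
/-- Since `f₀` is differentiable at `α`, the initial data differ by at most `a ‖β - α‖` for `β` near
`α`, and so the quadratic error of the objective is `O(‖β - α‖²)`. -/
theorem hasFDerivAt_objective {A : Type*} [NormedAddCommGroup A] [NormedSpace ℝ A] {U : Set A}
    (hU : IsOpen U) (hT : 0 ≤ T) (hk : 0 ≤ k) (hq : q.RateBound Λ) {C : ℝ} (hr : IsTest k C r)
    {f₀ : A → WeightedL1 k} {f₀' : A →L[ℝ] WeightedL1 k} {f : A → ℝ → Vel → ℝ}
    (hf : ∀ α ∈ U, IsSolution q k T (f α)) (hf_init : ∀ α ∈ U, ∀ᵐ v : Vel, f α 0 v = f₀ α v)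
    {α : A} (hα : α ∈ U) (hf₀ : HasFDerivAt f₀ f₀' α)
    (hγ : IsAdjointSolution q k T (f α) r γ) :
    ∃ gradJ : A →L[ℝ] ℝ, HasFDerivAt (objective r T f) gradJ α ∧
      ∀ h : A, Integrable (fun v => γ 0 v * f₀' h v) ∧ gradJ h = -∫ v, γ 0 v * f₀' h v := by
  obtain ⟨B, hB⟩ := hγ.exists_isTest
  obtain ⟨M, hM0, hM⟩ := (hf α hα).exists_bound
  have h0 : (0 : ℝ) ∈ Icc 0 T := ⟨le_rfl, hT⟩
  obtain ⟨ℓ, hℓ⟩ := (hB 0 h0).exists_functional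
  refine ⟨-(ℓ.comp f₀'), ?_, fun h => ⟨(hℓ _).1, by simp [(hℓ _).2]⟩⟩
  set E := Real.exp ((2 * Λ * (2 * M + 1) + 1) * T) with hE
  obtain ⟨a, ha, hO⟩ := hf₀.isBigO_sub.exists_pos
  have hinit (β : A) (hβ : β ∈ U) :
      toWeightedL1 k (fun v => f β 0 v - f α 0 v) = f₀ β - f₀ α := by
    rw [((hf β hβ).memL1 h0).toWeightedL1_sub ((hf α hα).memL1 h0),
      ((hf β hβ).memL1 h0).toWeightedL1_eq_of_ae (hf_init β hβ),
      ((hf α hα).memL1 h0).toWeightedL1_eq_of_ae (hf_init α hα)]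
  have hquad : (fun β => objective r T f β - objective r T f α + ℓ (f₀ β - f₀ α)) =O[𝓝 α]
      fun β => ‖β - α‖ ^ 2 := by
    -- `a ‖β - α‖` is the size `δ` of the perturbation of the datum; it has to be positive for the
    -- barrier argument, which excludes `β = α`.
    refine IsBigO.of_bound (2 * B * Λ * (a * E) ^ 2 * T) ?_
    have hsmall : ∀ᶠ β in 𝓝 α, a * ‖β - α‖ * E ≤ 1 := by
      have : Tendsto (fun β => a * ‖β - α‖ * E) (𝓝 α) (𝓝 (a * ‖α - α‖ * E)) :=
        (by fun_prop : Continuous fun β => a * ‖β - α‖ * E).tendsto α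
      rw [sub_self, norm_zero, mul_zero, zero_mul] at this
      exact this.eventually_le_const one_pos
    filter_upwards [hU.mem_nhds hα, hO.bound, hsmall] with β hβ hOβ hs
    rcases eq_or_ne β α with rfl | hne
    · simp
    have hd0 := ((hf β hβ).memL1 h0).sub ((hf α hα).memL1 h0)
    have hδ : 0 < a * ‖β - α‖ := mul_pos ha (norm_pos_iff.2 (sub_ne_zero.2 hne))
    have hD (t : ℝ) (ht : t ∈ Icc 0 T) :
        wnorm k (fun v => f β t v - f α t v) ≤ a * ‖β - α‖ * E :=
      (hf α hα).wnorm_sub_le_exp hk hq (hf β hβ) hM hδ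
        (by rw [← hd0.norm_toWeightedL1, hinit β hβ]; exact hOβ) hs ht
    have h := hγ.abs_objective_sub_le hT hk hq (hf α hα) (hf β hβ) hB hr hD
    rw [← hd0.integral_mul_toWeightedL1, hinit β hβ, ← (hℓ _).2] at h
    rw [Real.norm_eq_abs, norm_pow, norm_norm]
    refine h.trans_eq ?_
    ring
  have h1 := hquad.trans_isLittleO (isLittleO_pow_sub_sub α (m := 2) (by norm_num))
  have h2 := (ℓ.isBigO_comp (fun β => f₀ β - f₀ α - f₀' (β - α)) (𝓝 α)).trans_isLittleO
    hf₀.isLittleO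
  refine .of_isLittleO ((h1.sub h2).congr_left fun β => ?_)
  simp only [map_sub, neg_apply, ContinuousLinearMap.comp_apply]
  ring

end Boltzmann

theorem mainTheorem3
    (q : Boltzmann.CollisionKernel)
    {A : Type*} [NormedAddCommGroup A] [NormedSpace ℝ A]
    (U : Set A) (hU : IsOpen U)
    (T : ℝ) (hT : 0 < T) (k : ℝ) (hk : 0 ≤ k)
    (r : Boltzmann.Vel → ℝ) (hr : Measurable r)
    (hr_growth : ∃ C : ℝ, ∀ v, |r v| ≤ C * Boltzmann.weight k v)
    (f₀ : A → Boltzmann.WeightedL1 k) (f₀' : A → A →L[ℝ] Boltzmann.WeightedL1 k)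
    (hf₀ : ∀ α ∈ U, HasFDerivAt f₀ (f₀' α) α)
    (f : A → ℝ → Boltzmann.Vel → ℝ)
    (hf : ∀ α ∈ U, Boltzmann.IsSolution q k T (f α))
    (hf_init : ∀ α ∈ U, ∀ᵐ v : Boltzmann.Vel, f α 0 v = f₀ α v) :
    (∀ g : Boltzmann.Vel → ℝ, Measurable g → (∀ᵐ v : Boltzmann.Vel, 0 < g v) →
      Boltzmann.IsAdjointPair q g) ∧
    (q.IsCutoff → ∀ α ∈ U,
      (∃ γ : ℝ → Boltzmann.Vel → ℝ, Boltzmann.IsAdjointSolution q k T (f α) r γ) ∧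
      ∀ γ : ℝ → Boltzmann.Vel → ℝ, Boltzmann.IsAdjointSolution q k T (f α) r γ →
        ∃ gradJ : A →L[ℝ] ℝ,
          HasFDerivAt (Boltzmann.objective r T f) gradJ α ∧
          ∀ h : A,
            Integrable (fun v => γ 0 v * f₀' α h v) ∧
            gradJ h = -∫ v, γ 0 v * f₀' α h v) := by
  refine ⟨fun g _ hg => Boltzmann.isAdjointPair q hg, fun hcut α hα => ?_⟩
  obtain ⟨Λ, hq⟩ := hcut.exists_rateBound
  obtain ⟨C, hC⟩ := hr_growth
  have hr' : Boltzmann.IsTest k C r := ⟨hr, hC⟩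
  exact ⟨(hf α hα).exists_isAdjointSolution hT.le hk hq hr', fun γ hγ =>
    Boltzmann.hasFDerivAt_objective hU hT.le hk hq hr' hf hf_init hα (hf₀ α hα) hγ⟩
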